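/- **Setting.** For a nonzero real matrix $M$ let $\mathrm{st}(M)=\|M\|_F^2/\|M\|_{\mathrm{op}}^2$ be its stable rank ($\mathrm{st}(0):=0$), where $\|\cdot\|_{\mathrm{op}}$ is the largest singular value. For $X=[x_1,\dots,x_n]\in\mathbf R^{d\times n}$ let $\mathrm{RMSNorm}(X)$ be the matrix with columns $\sqrt d\,x_t/\|x_t\|_2$. Let $L,n_{\mathrm{head}},d,k,n\ge 1$ with $d=n_{\mathrm{head}}\,d_{\mathrm{head}}$. *Embedding.* Let $(i_1,\dots,i_n)\in\{1,\dots,V\}^n$ be a fixed token sequence, $p_{\max}=\max_j \frac1n|\{t:i_t=j\}|$, let $E\in\mathbf R^{d\times V}$ have i.i.d. $\mathcal N(0,1)$ entries with columns $e_j$, and let $X^{(0)}=[e_{i_1},\dots,e_{i_n}]$. *Activation.* Let $\sigma:\mathbf R\to\mathbf R$ be $1$-Lipschitz with $\sigma(0)=0$, applied entrywise, and let $\mathrm{st}_\sigma\in\mathbf R$, $p_\sigma>0$ and numbers $P(\sigma,d,k,n)$ be such that for all dimensions $d,k,n\ge1$, every $X\in\mathbf R^{d\times n}$ with equal column norms,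 and $W\in\mathbf R^{k\times d}$ with i.i.d. $\mathcal N(0,1/d)$ entries, with probability at least $P(\sigma,d,k,n)$ both $\mathrm{st}(\sigma(WX))\le \mathrm{st}_\sigma$ and $\|\sigma(WX)\|_F^2\ge \frac{k p_\sigma}{d}\|X\|_F^2$ hold. *Network.* For $\ell=0,\dots,L-1$ set $$A^{\mathrm{rms},(\ell)}=\mathrm{RMSNorm}(X^{(\ell)}),\qquad X^{\mathrm{att},(\ell)}=X^{(\ell)}+W_O^{(\ell)}\,\mathrm{Concat}_{h\le n_{\mathrm{head}}}\bigl(W_V^{(h,\ell)}A^{\mathrm{rms},(\ell)}P^{(h,\ell)}\bigr),$$ $$A^{\mathrm{rms},(\ell)}_{\mathrm{mlp}}=\mathrm{RMSNorm}(X^{\mathrm{att},(\ell)}),\qquad B^{(\ell)}=\sigma\bigl(W_1^{(\ell)}A^{\mathrm{rms},(\ell)}_{\mathrm{mlp}}\bigr),\qquad X^{(\ell+1)}=X^{\mathrm{att},(\ell)}+W_2^{(\ell)}B^{(\ell)},$$ and $A^{\mathrm{rms}}_{\mathrm{final}}=\mathrm{RMSNorm}(X^{(L)})$, where $\mathrm{Concat}$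 stacks the $n_{\mathrm{head}}$ blocks vertically. The matrices $W_O^{(\ell)}\in\mathbf R^{d\times d}$, $W_V^{(h,\ell)}\in\mathbf R^{d_{\mathrm{head}}\times d}$, $W_1^{(\ell)}\in\mathbf R^{k\times d}$ have i.i.d. $\mathcal N(0,1/d)$ entries and $W_2^{(\ell)}\in\mathbf R^{d\times k}$ has i.i.d. $\mathcal N(0,1/k)$ entries; the weight matrices of one layer are mutually independent. The $P^{(h,\ell)}\in\mathbf R^{n\times n}$ are arbitrary random matrices whose columns are probability vectors, and for every $\ell$ the weights of layer $\ell$ are independent of the collection formed by $E$, all weights of the layers before $\ell$, and all mixing matrices $P^{(h,\ell')}$ with $\ell'\le\ell$. (So all weights are mutually independent of each other and of $E$, and $P^{(h,\ell)}$ may depend on the input $X^{(\ell)}$ of its layer and on external randomness.) **Theorem.** There are universal numerical constants $c,C>0$ such that in every such setting with $$d\ge C L^2\log(nL),\qquad k\ge C L^2\log(nL),$$ with probability at least $$1- C L e^{-c d/L^2}- C L e^{-c k/L^2}- L\bigl(1-P(\sigma,d,k,n)\bigr)$$ all of the following hold: 1. $\mathrm{st}(B^{(\ell)})\le \mathrm{st}_\sigma$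 for every $\ell=0,\dots,L-1$; 2. $\mathrm{st}(X^{(0)})\le \dfrac{1.01}{p_{\max}}$, $\ \mathrm{st}(A^{\mathrm{rms},(0)})\le \dfrac{1.03}{p_{\max}}$, $\ \mathrm{st}(A^{\mathrm{rms},(0)}_{\mathrm{mlp}})\le \dfrac{6.03}{p_{\max}}$; 3. for every $\ell=1,\dots,L-1$, $$\mathrm{st}(A^{\mathrm{rms},(\ell)})\le 2.1\,\mathrm{st}_\sigma(1+\ell)+4.3\,\frac{\mathrm{st}_\sigma}{p_\sigma}\,\ell(\ell+1),\qquad \mathrm{st}(A^{\mathrm{rms},(\ell)}_{\mathrm{mlp}})\le 6.4\,\mathrm{st}_\sigma(1+\ell)+13\,\frac{\mathrm{st}_\sigma}{p_\sigma}\,\ell(\ell+1),$$ and $\ \mathrm{st}(A^{\mathrm{rms}}_{\mathrm{final}})\le 2.1\,\mathrm{st}_\sigma(1+L)+4.3\,\dfrac{\mathrm{st}_\sigma}{p_\sigma}\,L(L+1)$. -/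

import Mathlib

open MeasureTheory ProbabilityTheory
open scoped NNReal

namespace MSITransformer

noncomputable section

/-! ### Matrix quantities -/

/-- Squared Frobenius norm. -/
def frobSq {a b : ℕ} (M : Matrix (Fin a) (Fin b) ℝ) : ℝ := ∑ i, ∑ j, M i j ^ 2

open scoped Matrix.Norms.L2Operator in
/-- Operator norm between Euclidean spaces (largest singular value). -/
def opNorm {a b : ℕ} (M : Matrix (Fin a) (Fin b) ℝ) : ℝ := ‖M‖

/-- Stable rank `‖M‖_F² / ‖M‖_op²` (with value `0` at the zero matrix). -/
def stableRank {a b : ℕ} (M : Matrix (Fin a) (Fin b) ℝ) : ℝ := frobSq M / opNorm M ^ 2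

/-- Euclidean norm of the `t`-th column. -/
def colNorm {a b : ℕ} (M : Matrix (Fin a) (Fin b) ℝ) (t : Fin b) : ℝ := √(∑ i, M i t ^ 2)

/-- Parameter-free RMS normalization: the `t`-th column becomes `√d · x_t / ‖x_t‖₂`. -/
def rmsNorm {d n : ℕ} (X : Matrix (Fin d) (Fin n) ℝ) : Matrix (Fin d) (Fin n) ℝ :=
  Matrix.of fun i t => √(d : ℝ) * (X i t / colNorm X t)

/-- Every column is a probability vector. -/
def ColumnStochastic {n : ℕ} (P : Matrix (Fin n) (Fin n) ℝ) : Prop :=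
  (∀ i t, 0 ≤ P i t) ∧ ∀ t, ∑ i, P i t = 1

/-- Matrices carry the entrywise (product) σ-algebra. -/
instance matrixMeasurableSpace {m n : Type*} : MeasurableSpace (Matrix m n ℝ) :=
  (MeasurableSpace.pi : MeasurableSpace (m → n → ℝ))

/-- Law of an `a × b` random matrix with i.i.d. entries `N(0, v)`. -/
def gaussianMatrix (a b : ℕ) (v : ℝ≥0) : Measure (Matrix (Fin a) (Fin b) ℝ) :=
  Measure.pi fun _ : Fin a => Measure.pi fun _ : Fin b => gaussianReal 0 v

/-! ### Activation function -/

/-- The mean-spike assumption on the activation `σ`, with stable-rank level `stσ`, Frobenius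
level `pσ` and success probability `Psucc d k n`: for every `X ∈ ℝ^{d × n}` whose columns have
equal norms and a Gaussian `W ∈ ℝ^{k × d}` with i.i.d. `N(0, 1/d)` entries, both bounds hold with
probability at least `Psucc d k n`. -/
structure MeanSpike (σ : ℝ → ℝ) (stσ pσ : ℝ) (Psucc : ℕ → ℕ → ℕ → ℝ) : Prop where
  lipschitz : LipschitzWith 1 σ
  map_zero : σ 0 = 0
  bound : ∀ d k n : ℕ, 1 ≤ d → 1 ≤ k → 1 ≤ n → ∀ X : Matrix (Fin d) (Fin n) ℝ,
    (∀ s t, colNorm X s = colNorm X t) →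
    Psucc d k n ≤ (gaussianMatrix k d (d : ℝ≥0)⁻¹).real
      {W | stableRank ((W * X).map σ) ≤ stσ ∧
        (k : ℝ) * pσ / d * frobSq X ≤ frobSq ((W * X).map σ)}

/-! ### Token embedding -/

/-- Empirical frequency of token `j`. -/
def tokenFreq {n V : ℕ} (tok : Fin n → Fin V) (j : Fin V) : ℝ :=
  ((Finset.univ.filter fun t => tok t = j).card : ℝ) / n

/-- Empirical frequency of the most common token. -/
def pMax {n V : ℕ} (tok : Fin n → Fin V) : ℝ := ⨆ j, tokenFreq tok j

/-- Embedded sequence: the `t`-th column is the embedding of the `t`-th token. -/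
def embed {d n V : ℕ} (tok : Fin n → Fin V) (E : Matrix (Fin d) (Fin V) ℝ) :
    Matrix (Fin d) (Fin n) ℝ :=
  E.submatrix id tok

/-! ### The transformer -/

/-- The matrices of one layer: mixing matrices `P`, value/output projections and MLP weights. -/
structure Layer (d nHead dHead k n : ℕ) where
  P : Fin nHead → Matrix (Fin n) (Fin n) ℝ
  WV : Fin nHead → Matrix (Fin dHead) (Fin d) ℝ
  WO : Matrix (Fin d) (Fin d) ℝ
  W1 : Matrix (Fin k) (Fin d) ℝ
  W2 : Matrix (Fin d) (Fin k) ℝ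

/-- Space of the Gaussian weights `(WV, WO, W1, W2)` of one layer. -/
abbrev WeightSpace (d nHead dHead k : ℕ) : Type :=
  (Fin nHead → Matrix (Fin dHead) (Fin d) ℝ) × Matrix (Fin d) (Fin d) ℝ ×
    Matrix (Fin k) (Fin d) ℝ × Matrix (Fin d) (Fin k) ℝ

/-- All weight matrices independent, entries i.i.d. centered Gaussian with variance
`1 / (input dimension)`. -/
def weightLaw (d nHead dHead k : ℕ) : Measure (WeightSpace d nHead dHead k) :=
  (Measure.pi fun _ : Fin nHead => gaussianMatrix dHead d (d : ℝ≥0)⁻¹).prod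
    ((gaussianMatrix d d (d : ℝ≥0)⁻¹).prod
      ((gaussianMatrix k d (d : ℝ≥0)⁻¹).prod (gaussianMatrix d k (k : ℝ≥0)⁻¹)))

/-- Stack the head outputs, head `0` on top. -/
def concatHeads {d nHead dHead n : ℕ} (hd : d = nHead * dHead)
    (H : Fin nHead → Matrix (Fin dHead) (Fin n) ℝ) : Matrix (Fin d) (Fin n) ℝ :=
  Matrix.of fun i t =>
    H (finProdFinEquiv.symm (Fin.cast hd i)).1 (finProdFinEquiv.symm (Fin.cast hd i)).2 t

namespace Layer

variable {d nHead dHead k n : ℕ}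

/-- The Gaussian weights of the layer. -/
def weights (θ : Layer d nHead dHead k n) : WeightSpace d nHead dHead k :=
  (θ.WV, θ.WO, θ.W1, θ.W2)

/-- Output `X + W_O · Concat_h (W_V^h · RMSNorm(X) · P^h)` of the attention sublayer. -/
def att (θ : Layer d nHead dHead k n) (hd : d = nHead * dHead) (X : Matrix (Fin d) (Fin n) ℝ) :
    Matrix (Fin d) (Fin n) ℝ :=
  X + θ.WO * concatHeads hd fun h => θ.WV h * (rmsNorm X * θ.P h)

/-- MLP post-activations `σ(W₁ · RMSNorm(X^att))`. -/
def postAct (θ : Layer d nHead dHead k n) (hd : d = nHead * dHead) (σ : ℝ → ℝ)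
    (X : Matrix (Fin d) (Fin n) ℝ) : Matrix (Fin k) (Fin n) ℝ :=
  (θ.W1 * rmsNorm (θ.att hd X)).map σ

/-- Output `X^att + W₂ · B` of the layer. -/
def out (θ : Layer d nHead dHead k n) (hd : d = nHead * dHead) (σ : ℝ → ℝ)
    (X : Matrix (Fin d) (Fin n) ℝ) : Matrix (Fin d) (Fin n) ℝ :=
  θ.att hd X + θ.W2 * θ.postAct hd σ X

end Layer

section Forward

variable {L d nHead dHead k n : ℕ} (hd : d = nHead * dHead) (σ : ℝ → ℝ)
  (θ : Fin L → Layer d nHead dHead k n) (X₀ : Matrix (Fin d) (Fin n) ℝ)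

/-- Residual stream `X^(ℓ)`, `ℓ = 0, …, L`. -/
def hidden (ℓ : Fin (L + 1)) : Matrix (Fin d) (Fin n) ℝ :=
  Fin.induction (motive := fun _ => Matrix (Fin d) (Fin n) ℝ) X₀
    (fun j X => (θ j).out hd σ X) ℓ

/-- `A^{rms,(ℓ)} = RMSNorm(X^(ℓ))`. -/
def Arms (ℓ : Fin L) : Matrix (Fin d) (Fin n) ℝ := rmsNorm (hidden hd σ θ X₀ ℓ.castSucc)

/-- `A^{rms,(ℓ)}_{mlp} = RMSNorm(X^{att,(ℓ)})`. -/
def Amlp (ℓ : Fin L) : Matrix (Fin d) (Fin n) ℝ :=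
  rmsNorm ((θ ℓ).att hd (hidden hd σ θ X₀ ℓ.castSucc))

/-- `B^(ℓ) = σ(W₁^(ℓ) A^{rms,(ℓ)}_{mlp})`. -/
def B (ℓ : Fin L) : Matrix (Fin k) (Fin n) ℝ :=
  (θ ℓ).postAct hd σ (hidden hd σ θ X₀ ℓ.castSucc)

/-- `A^{rms}_{final} = RMSNorm(X^(L))`. -/
def Afinal : Matrix (Fin d) (Fin n) ℝ := rmsNorm (hidden hd σ θ X₀ (Fin.last L))

end Forward

/-- Gaussian initialization of an `L`-layer transformer on a probability space. The embedding has
i.i.d. standard Gaussian entries; the weights of each layer are independent Gaussian matrices; the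
mixing matrices are random column-stochastic matrices; and the weights of layer `ℓ` are
independent of everything that precedes them, that is, of the embedding, the weights of the earlier
layers and the mixing matrices up to and including layer `ℓ`. In particular all weights are
mutually independent, and the mixing matrices of layer `ℓ` may depend on the input of that layer
and on further external randomness. -/
structure GaussianInit {L d nHead dHead k n V : ℕ} {Ω : Type*} [MeasurableSpace Ω] (μ : Measure Ω)
    (E : Ω → Matrix (Fin d) (Fin V) ℝ) (θ : Fin L → Ω → Layer d nHead dHead k n) : Prop where
  law_embedding : HasLaw E (gaussianMatrix d V 1) μ
  law_weights : ∀ ℓ, HasLaw (fun ω => (θ ℓ ω).weights) (weightLaw d nHead dHead k) μ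
  measurable_P : ∀ ℓ h, Measurable fun ω => (θ ℓ ω).P h
  stochastic_P : ∀ ℓ h ω, ColumnStochastic ((θ ℓ ω).P h)
  indep : ∀ ℓ, IndepFun
    (fun ω => (E ω, (fun j : {j : Fin L // j < ℓ} => (θ j ω).weights),
      fun j : {j : Fin L // j ≤ ℓ} => (θ j ω).P))
    (fun ω => (θ ℓ ω).weights) μ

end

end MSITransformer

namespace MSITransformer

noncomputable section

/-! ### Gaussian matrices -/

-- Both sublayers have the form `X' = Y + G * Z`, where `G` is a fresh Gaussian matrix independent
-- of `Y` and `Z`. For a fixed vector `w`, `‖X' w‖²` concentrates around `‖Y w‖² + ρ ‖Z w‖²`, where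
-- `ρ` is the number of rows of `G` times the entry variance. A lower bound on the operator norm of
-- `X'` needs only one test vector. Testing norm-attaining vectors of `Y` and of `Z` shows that `X'`
-- keeps almost all of `‖Y‖_op²` and almost all of `ρ ‖Z‖_op²`, with no net argument
-- (`measureReal_not_matUpdate_le`).
--
-- Normalization makes the Frobenius norm of `rmsNorm X` at most `√(n d)`. It lowers the operator
-- norm by at most the factor `max_t ‖x_t‖ / √d` (`opNorm_sq_le_rmsNorm`). Two estimates therefore
-- suffice.
--
-- Lower bound: the post-activations `B` have small stable rank and large Frobenius norm, hence
-- large operator norm, and the last MLP update passes this to the residual stream: `‖X^(ℓ)‖_op² ≥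
-- 0.996 n d pσ / stσ` for `ℓ ≥ 1` (`opNorm_out_sq_ge`). At the embedding, the `n * pMax` equal
-- columns play this role (`opNorm_embed_sq_ge`).
--
-- Upper bound: normalized columns have norm at most `√d`, averaging over probability vectors is a
-- contraction, and `σ` is 1-Lipschitz. Each increment thus has column norm about `√d` at most, and
-- column norms of `X^(ℓ)` stay below `1.05 (1 + ℓ) √d` (`colNorm_hidden_sq_le`). Dividing gives the
-- quadratic growth in `ℓ`.
--
-- The accuracy `δ = 1/500` is the same for all depths. Independence of a layer's weights from its
-- input and mixing matrices allows these to be frozen by Fubini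
-- (`GaussianInit.measureReal_not_concentrated_le`); a union bound over the embedding and the layers
-- finishes the proof.

instance isProbabilityMeasure_gaussianMatrix (a b : ℕ) (v : ℝ≥0) :
    IsProbabilityMeasure (gaussianMatrix a b v) :=
  inferInstanceAs (IsProbabilityMeasure (α := Fin a → Fin b → ℝ)
    (Measure.pi fun _ => Measure.pi fun _ => gaussianReal 0 v))

lemma exp_sq_mul_gaussianPDFReal {s : ℝ≥0} (hs : s ≠ 0) (τ x : ℝ) :
    gaussianPDFReal 0 s x * Real.exp (τ * x ^ 2)
      = (√(2 * Real.pi * s))⁻¹ * Real.exp (-((1 - 2 * τ * s) / (2 * s)) * x ^ 2) := by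
  have hs' : (s : ℝ) ≠ 0 := by exact_mod_cast hs
  rw [gaussianPDFReal, mul_assoc, ← Real.exp_add]
  congr 2
  field_simp
  ring

lemma integrable_exp_sq_gaussianReal (s : ℝ≥0) {τ : ℝ} (h : 2 * τ * s < 1) :
    Integrable (fun x => Real.exp (τ * x ^ 2)) (gaussianReal 0 s) := by
  by_cases hs : s = 0
  · subst hs
    rw [gaussianReal_zero_var]
    exact integrable_dirac (by simp)
  have hs' : 0 < (s : ℝ) := by positivity
  rw [gaussianReal_of_var_ne_zero _ hs, integrable_withDensity_iff_integrable_smul₀'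
    (measurable_gaussianPDF _ _).aemeasurable (ae_of_all _ fun _ => gaussianPDF_lt_top)]
  simp only [toReal_gaussianPDF, smul_eq_mul, exp_sq_mul_gaussianPDFReal hs]
  exact (integrable_exp_neg_mul_sq (div_pos (by linarith) (by positivity))).const_mul _

lemma integral_exp_sq_gaussianReal (s : ℝ≥0) {τ : ℝ} (h : 2 * τ * s < 1) :
    ∫ x, Real.exp (τ * x ^ 2) ∂gaussianReal 0 s = (√(1 - 2 * τ * s))⁻¹ := by
  by_cases hs : s = 0
  · subst hs
    simp [gaussianReal_zero_var]
  have hs' : 0 < (s : ℝ) := by positivity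
  rw [integral_gaussianReal_eq_integral_smul hs]
  simp only [smul_eq_mul, exp_sq_mul_gaussianPDFReal hs]
  rw [integral_const_mul, integral_gaussian, ← Real.sqrt_inv, ← Real.sqrt_inv,
    ← Real.sqrt_mul (by positivity)]
  congr 1
  have : 1 - 2 * τ * s ≠ 0 := by linarith
  have := Real.pi_pos
  field_simp

/-- A linear functional of a vector with i.i.d. centered Gaussian entries is Gaussian. -/
lemma map_sum_mul_pi_gaussianReal {b : ℕ} (v : ℝ≥0) (z : Fin b → ℝ) :
    (Measure.pi fun _ : Fin b => gaussianReal 0 v).map (fun x => ∑ j, x j * z j)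
      = gaussianReal 0 (v * Real.toNNReal (∑ j, z j ^ 2)) := by
  have hm : Measurable (fun x : Fin b → ℝ => ∑ j, x j * z j) := by fun_prop
  have := Measure.isProbabilityMeasure_map
    (μ := Measure.pi fun _ : Fin b => gaussianReal 0 v) hm.aemeasurable
  apply Measure.ext_of_charFun
  ext t
  rw [charFun_gaussianReal, charFun_apply_real, integral_map hm.aemeasurable (by fun_prop)]
  have : ∀ x : Fin b → ℝ, Complex.exp (t * ((∑ j, x j * z j : ℝ) : ℂ) * Complex.I)
      = ∏ j, Complex.exp (((t * z j : ℝ) : ℂ) * (x j : ℂ) * Complex.I) := by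
    intro x
    rw [← Complex.exp_sum]
    congr 1
    push_cast
    rw [Finset.mul_sum, Finset.sum_mul]
    exact Finset.sum_congr rfl fun j _ => by ring
  simp_rw [this]
  rw [integral_fintype_prod_eq_prod
    (f := fun j (y : ℝ) => Complex.exp (((t * z j : ℝ) : ℂ) * (y : ℂ) * Complex.I))]
  simp_rw [← charFun_apply_real, charFun_gaussianReal]
  rw [← Complex.exp_sum]
  congr 1
  have h0 : 0 ≤ ∑ j, z j ^ 2 := Finset.sum_nonneg fun j _ => sq_nonneg _
  have h1 : ((v * Real.toNNReal (∑ j, z j ^ 2) : ℝ≥0) : ℂ) = (v : ℂ) * ∑ j, (z j : ℂ) ^ 2 := by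
    rw [show ∀ x : ℝ≥0, (x : ℂ) = ((x : ℝ) : ℂ) from fun _ => rfl, NNReal.coe_mul, Real.coe_toNNReal _ h0]
    push_cast; rfl
  rw [h1]
  simp only [Complex.ofReal_zero, mul_zero, zero_mul, zero_sub, Finset.sum_neg_distrib]
  rw [Finset.mul_sum, Finset.sum_mul, Finset.sum_div]
  congr 1
  exact Finset.sum_congr rfl fun j _ => by push_cast; ring

-- Moments of `G z` for a Gaussian matrix `G`

section Row
variable {a b : ℕ} (v : ℝ≥0) (z : Fin b → ℝ)

lemma coe_rowVariance : ((v * Real.toNNReal (∑ j, z j ^ 2) : ℝ≥0) : ℝ) = v * ∑ j, z j ^ 2 := by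
  rw [NNReal.coe_mul, Real.coe_toNNReal _ (Finset.sum_nonneg fun j _ => sq_nonneg _)]

/-- The rows of `G` are independent, so the coordinates of `G z` are i.i.d. with variance `v ‖z‖²`,
and expectations of products over coordinates factor. The same reason gives the integral formula
that follows. -/
lemma integrable_prod_mulVec_gaussianMatrix (f : Fin a → ℝ → ℝ)
    (hi : ∀ i, Integrable (f i) (gaussianReal 0 (v * Real.toNNReal (∑ j, z j ^ 2)))) :
    Integrable (fun G : Matrix (Fin a) (Fin b) ℝ => ∏ i, f i (G.mulVec z i))
      (gaussianMatrix a b v) := by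
  unfold gaussianMatrix
  refine Integrable.fintype_prod (f := fun i (x : Fin b → ℝ) => f i (∑ j, x j * z j)) fun i => ?_
  have := hi i
  rw [← map_sum_mul_pi_gaussianReal] at this
  exact this.comp_measurable (by fun_prop)

lemma integral_prod_mulVec_gaussianMatrix (f : Fin a → ℝ → ℝ) (hf : ∀ i, Continuous (f i)) :
    ∫ G : Matrix (Fin a) (Fin b) ℝ, ∏ i, f i (G.mulVec z i) ∂gaussianMatrix a b v
      = ∏ i, ∫ x, f i x ∂gaussianReal 0 (v * Real.toNNReal (∑ j, z j ^ 2)) := by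
  unfold gaussianMatrix
  rw [← map_sum_mul_pi_gaussianReal]
  have : ∀ i, ∫ x, f i x ∂((Measure.pi fun _ : Fin b => gaussianReal 0 v).map
      fun x => ∑ j, x j * z j) = ∫ x, f i (∑ j, x j * z j)
        ∂Measure.pi fun _ : Fin b => gaussianReal 0 v := fun i =>
    integral_map (Measurable.aemeasurable (by fun_prop)) (hf i).aestronglyMeasurable
  simp_rw [this]
  exact integral_fintype_prod_eq_prod
    (f := fun i (x : Fin b → ℝ) => f i (∑ j, x j * z j))

lemma integrable_exp_sq_mulVec {τ : ℝ} (h : 2 * τ * (v * ∑ j, z j ^ 2) < 1) :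
    Integrable (fun G : Matrix (Fin a) (Fin b) ℝ => Real.exp (τ * ∑ i, G.mulVec z i ^ 2))
      (gaussianMatrix a b v) := by
  simp_rw [Finset.mul_sum, Real.exp_sum]
  refine integrable_prod_mulVec_gaussianMatrix v z (fun _ x => Real.exp (τ * x ^ 2))
    fun _ => integrable_exp_sq_gaussianReal _ ?_
  rwa [coe_rowVariance]

lemma integral_exp_sq_mulVec {τ : ℝ} (h : 2 * τ * (v * ∑ j, z j ^ 2) < 1) :
    ∫ G : Matrix (Fin a) (Fin b) ℝ, Real.exp (τ * ∑ i, G.mulVec z i ^ 2) ∂gaussianMatrix a b v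
      = (√(1 - 2 * τ * (v * ∑ j, z j ^ 2)))⁻¹ ^ a := by
  simp_rw [Finset.mul_sum _ _ τ, Real.exp_sum]
  rw [integral_prod_mulVec_gaussianMatrix v z (fun _ x => Real.exp (τ * x ^ 2))
    (fun _ => by fun_prop)]
  simp only [Finset.prod_const, Finset.card_univ, Fintype.card_fin]
  rw [integral_exp_sq_gaussianReal, coe_rowVariance]
  rwa [coe_rowVariance]

end Row

/-- One-coordinate Chernoff factor for the upper chi-square tail. With `(1 - 2τ)^(-1/2) ≤ exp (τ +
4τ²)` the exponent becomes `4τ² - τδ`, which equals `-δ²/16` at `τ = δ/8`. -/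
lemma inv_sqrt_one_sub_le {τ δ : ℝ} (hδ0 : 0 < δ) (hδ1 : δ ≤ 1) (hτ : τ = δ / 8) :
    (√(1 - 2 * τ))⁻¹ * Real.exp (-(τ * (1 + δ))) ≤ Real.exp (-(δ ^ 2 / 16)) := by
  have h1 : 0 < 1 - 2 * τ := by rw [hτ]; linarith
  have h2 : (√(1 - 2 * τ))⁻¹ ≤ Real.exp (τ + 4 * τ ^ 2) := by
    rw [← Real.sqrt_inv]
    apply Real.sqrt_le_iff.mpr ⟨by positivity, ?_⟩
    rw [sq, ← Real.exp_add]
    refine le_trans ?_ (Real.add_one_le_exp _)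
    rw [inv_le_iff_one_le_mul₀ h1]
    rw [hτ]
    nlinarith [sq_nonneg δ, mul_pos hδ0 hδ0, mul_nonneg (sq_nonneg δ) (sub_nonneg.mpr hδ1)]
  calc _ ≤ Real.exp (τ + 4 * τ ^ 2) * Real.exp (-(τ * (1 + δ))) := by gcongr
    _ = _ := by rw [← Real.exp_add, hτ]; congr 1; ring

/-- Counterpart for the lower tail: the exponent `2τ² - τδ = -3δ²/32` is even smaller, and is
rounded up to match the upper tail. -/
lemma inv_sqrt_one_add_le {τ δ : ℝ} (hδ0 : 0 < δ) (hτ : τ = δ / 8) :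
    (√(1 + 2 * τ))⁻¹ * Real.exp (τ * (1 - δ)) ≤ Real.exp (-(δ ^ 2 / 16)) := by
  have h1 : 0 < 1 + 2 * τ := by rw [hτ]; linarith
  have h2 : (√(1 + 2 * τ))⁻¹ ≤ Real.exp (-τ + 2 * τ ^ 2) := by
    rw [← Real.sqrt_inv]
    apply Real.sqrt_le_iff.mpr ⟨by positivity, ?_⟩
    rw [sq, ← Real.exp_add]
    refine le_trans ?_ (Real.add_one_le_exp _)
    rw [inv_le_iff_one_le_mul₀ h1]
    rw [hτ]
    have : 0 < δ ^ 3 := by positivity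
    nlinarith
  calc _ ≤ Real.exp (-τ + 2 * τ ^ 2) * Real.exp (τ * (1 - δ)) := by gcongr
    _ = Real.exp (2 * τ ^ 2 - τ * δ) := by rw [← Real.exp_add]; congr 1; ring
    _ ≤ _ := by
      rw [Real.exp_le_exp, hτ]; nlinarith [sq_nonneg δ]

lemma exp_mul_inv_sqrt_pow_le {δ s : ℝ} (hδ0 : 0 < δ) (hδ1 : δ ≤ 1) (hs : 0 < s) (a : ℕ) :
    Real.exp (-(δ / 8 / s) * ((1 + δ) * a * s)) * ((√(1 - 2 * (δ / 8)))⁻¹) ^ a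
      ≤ Real.exp (-(δ ^ 2 / 16 * a)) := by
  calc _ = ((√(1 - 2 * (δ / 8)))⁻¹ * Real.exp (-(δ / 8 * (1 + δ)))) ^ a := by
        rw [mul_pow, ← Real.exp_nat_mul, mul_comm]
        congr 2
        field_simp
    _ ≤ (Real.exp (-(δ ^ 2 / 16))) ^ a := by
        gcongr
        exact inv_sqrt_one_sub_le hδ0 hδ1 rfl
    _ = _ := by rw [← Real.exp_nat_mul]; congr 1; ring

/-- Upper tail for the stacked products `W_h u_h` of independent Gaussian matrices. -/
lemma measureReal_pi_gaussianMatrix_sq_ge {m a b : ℕ} (v : ℝ≥0) (u : Fin m → Fin b → ℝ) {δ s : ℝ}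
    (hδ0 : 0 < δ) (hδ1 : δ ≤ 1) (hs : 0 < s) (hu : ∀ h, v * ∑ j, u h j ^ 2 ≤ s) :
    (Measure.pi fun _ : Fin m => gaussianMatrix a b v).real
      {W | (1 + δ) * (m * a : ℕ) * s ≤ ∑ h, ∑ i, (W h).mulVec (u h) i ^ 2}
      ≤ Real.exp (-(δ ^ 2 / 16 * (m * a : ℕ))) := by
  set τ : ℝ := δ / 8 with hτ
  have hlt : ∀ h, 2 * (τ / s) * (v * ∑ j, u h j ^ 2) ≤ 2 * τ := fun h => by
    calc _ ≤ 2 * (τ / s) * s := by gcongr; exact hu h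
      _ = _ := by field_simp
  have hτ1 : 2 * τ < 1 := by rw [hτ]; linarith
  have hprod : ∀ W : Fin m → Matrix (Fin a) (Fin b) ℝ,
      Real.exp (τ / s * ∑ h, ∑ i, (W h).mulVec (u h) i ^ 2)
        = ∏ h, Real.exp (τ / s * ∑ i, (W h).mulVec (u h) i ^ 2) := fun W => by
    rw [Finset.mul_sum, Real.exp_sum]
  have hint : Integrable (fun W : Fin m → Matrix (Fin a) (Fin b) ℝ =>
      Real.exp (τ / s * ∑ h, ∑ i, (W h).mulVec (u h) i ^ 2))
      (Measure.pi fun _ : Fin m => gaussianMatrix a b v) := by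
    simp_rw [hprod]
    exact Integrable.fintype_prod (f := fun h (G : Matrix (Fin a) (Fin b) ℝ) =>
      Real.exp (τ / s * ∑ i, G.mulVec (u h) i ^ 2)) fun h =>
        integrable_exp_sq_mulVec v (u h) ((hlt h).trans_lt hτ1)
  refine (measure_ge_le_exp_mul_mgf (t := τ / s) _ (by positivity) hint).trans ?_
  have hmgf : mgf (fun W : Fin m → Matrix (Fin a) (Fin b) ℝ =>
      ∑ h, ∑ i, (W h).mulVec (u h) i ^ 2) (Measure.pi fun _ : Fin m => gaussianMatrix a b v) (τ / s)
      ≤ ((√(1 - 2 * τ))⁻¹) ^ (m * a) := by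
    unfold mgf
    simp_rw [hprod]
    rw [integral_fintype_prod_eq_prod (f := fun h (G : Matrix (Fin a) (Fin b) ℝ) =>
      Real.exp (τ / s * ∑ i, G.mulVec (u h) i ^ 2))]
    calc _ ≤ ∏ _h : Fin m, (√(1 - 2 * τ))⁻¹ ^ a := by
          refine Finset.prod_le_prod (fun h _ => integral_nonneg fun _ => (Real.exp_pos _).le) ?_
          intro h _
          rw [integral_exp_sq_mulVec v (u h) ((hlt h).trans_lt hτ1)]
          have : 0 < √(1 - 2 * τ) := Real.sqrt_pos.mpr (by linarith)
          gcongr ?_ ^ _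
          exact inv_anti₀ this (Real.sqrt_le_sqrt (by linarith [hlt h]))
      _ = _ := by simp [← pow_mul, mul_comm]
  calc _ ≤ Real.exp (-(τ / s) * ((1 + δ) * (m * a : ℕ) * s)) * ((√(1 - 2 * τ))⁻¹) ^ (m * a) := by
        gcongr
    _ ≤ _ := exp_mul_inv_sqrt_pow_le hδ0 hδ1 hs _

lemma measureReal_gaussianMatrix_sq_ge {a b : ℕ} (v : ℝ≥0) (z : Fin b → ℝ) {δ s : ℝ}
    (hδ0 : 0 < δ) (hδ1 : δ ≤ 1) (hs : 0 < s) (hz : v * ∑ j, z j ^ 2 ≤ s) :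
    (gaussianMatrix a b v).real {G | (1 + δ) * a * s ≤ ∑ i, G.mulVec z i ^ 2}
      ≤ Real.exp (-(δ ^ 2 / 16 * a)) := by
  set τ : ℝ := δ / 8 with hτ
  have hlt : 2 * (τ / s) * (v * ∑ j, z j ^ 2) ≤ 2 * τ := by
    calc _ ≤ 2 * (τ / s) * s := by gcongr
      _ = _ := by field_simp
  have hτ1 : 2 * τ < 1 := by rw [hτ]; linarith
  refine (measure_ge_le_exp_mul_mgf (t := τ / s) _ (by positivity)
    (integrable_exp_sq_mulVec v z (hlt.trans_lt hτ1))).trans ?_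
  unfold mgf
  rw [integral_exp_sq_mulVec v z (hlt.trans_lt hτ1)]
  have : 0 < √(1 - 2 * τ) := Real.sqrt_pos.mpr (by linarith)
  calc _ ≤ Real.exp (-(τ / s) * ((1 + δ) * a * s)) * ((√(1 - 2 * τ))⁻¹) ^ a := by
        gcongr
    _ ≤ _ := exp_mul_inv_sqrt_pow_le hδ0 hδ1 hs _

lemma measureReal_gaussianMatrix_sq_le {a b : ℕ} (v : ℝ≥0) (z : Fin b → ℝ) {δ : ℝ}
    (hδ0 : 0 < δ) (hz : 0 < v * ∑ j, z j ^ 2) :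
    (gaussianMatrix a b v).real
        {G | ∑ i, G.mulVec z i ^ 2 ≤ (1 - δ) * a * (v * ∑ j, z j ^ 2)}
      ≤ Real.exp (-(δ ^ 2 / 16 * a)) := by
  set s : ℝ := v * ∑ j, z j ^ 2 with hs
  set τ : ℝ := δ / 8 with hτ
  have hlt : 2 * (-(τ / s)) * s = -(2 * τ) := by field_simp
  have hτ0 : 0 < τ := by positivity
  have hlt1 : 2 * (-(τ / s)) * s < 1 := by rw [hlt]; linarith
  refine (measure_le_le_exp_mul_mgf (t := -(τ / s)) _ (neg_nonpos.mpr (by positivity))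
    (integrable_exp_sq_mulVec v z hlt1)).trans ?_
  unfold mgf
  rw [integral_exp_sq_mulVec v z hlt1, ← hs, hlt, sub_neg_eq_add]
  calc _ = ((√(1 + 2 * τ))⁻¹ * Real.exp (τ * (1 - δ))) ^ a := by
        rw [mul_pow, ← Real.exp_nat_mul, mul_comm]
        congr 2
        field_simp
    _ ≤ (Real.exp (-(δ ^ 2 / 16))) ^ a := by
        gcongr
        exact inv_sqrt_one_add_le hδ0 hτ
    _ = _ := by rw [← Real.exp_nat_mul]; congr 1; ring

lemma measureReal_gaussianMatrix_bilin_ge {a b : ℕ} (v : ℝ≥0) (y : Fin a → ℝ) (z : Fin b → ℝ)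
    {r : ℝ} (hr : 0 ≤ r) (hs : 0 < (∑ i, y i ^ 2) * (v * ∑ j, z j ^ 2)) :
    (gaussianMatrix a b v).real {G | r ≤ ∑ i, y i * G.mulVec z i}
      ≤ Real.exp (-(r ^ 2 / (2 * ((∑ i, y i ^ 2) * (v * ∑ j, z j ^ 2))))) := by
  set w : ℝ := v * ∑ j, z j ^ 2 with hw
  set S : ℝ := (∑ i, y i ^ 2) * w with hS
  -- The form `⟨y, G z⟩` is centred Gaussian of variance `S`, and `r / S` minimizes the Chernoff
  -- exponent `t² S / 2 - t r`.
  set t : ℝ := r / S with ht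
  have ht0 : 0 ≤ t := by positivity
  have hprod : ∀ G : Matrix (Fin a) (Fin b) ℝ,
      Real.exp (t * ∑ i, y i * G.mulVec z i) = ∏ i, Real.exp (t * y i * G.mulVec z i) := fun G => by
    rw [Finset.mul_sum, Real.exp_sum]; simp_rw [mul_assoc]
  have hint : Integrable (fun G : Matrix (Fin a) (Fin b) ℝ =>
      Real.exp (t * ∑ i, y i * G.mulVec z i)) (gaussianMatrix a b v) := by
    simp_rw [hprod]
    exact integrable_prod_mulVec_gaussianMatrix v z (fun i x => Real.exp (t * y i * x))
      fun i => integrable_exp_mul_gaussianReal _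
  refine (measure_ge_le_exp_mul_mgf (t := t) _ ht0 hint).trans ?_
  have hmgf : mgf (fun G : Matrix (Fin a) (Fin b) ℝ => ∑ i, y i * G.mulVec z i)
      (gaussianMatrix a b v) t = Real.exp (t ^ 2 * S / 2) := by
    unfold mgf
    simp_rw [hprod]
    rw [integral_prod_mulVec_gaussianMatrix v z (fun i x => Real.exp (t * y i * x))
      (fun _ => by fun_prop)]
    have : ∀ i, ∫ x, Real.exp (t * y i * x) ∂gaussianReal 0 (v * Real.toNNReal (∑ j, z j ^ 2))
        = Real.exp (w * (t * y i) ^ 2 / 2) := fun i => by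
      have := congrFun (mgf_id_gaussianReal (μ := 0) (v := v * Real.toNNReal (∑ j, z j ^ 2)))
        (t * y i)
      rw [coe_rowVariance, ← hw] at this
      simpa [mgf] using this
    simp_rw [this]
    rw [← Real.exp_sum, hS, Finset.sum_mul, Finset.mul_sum, Finset.sum_div]
    congr 1
    exact Finset.sum_congr rfl fun i _ => by ring
  rw [hmgf, ← Real.exp_add]
  apply le_of_eq
  congr 1
  rw [ht]
  field_simp
  ring

/-! ### Norms of matrices -/

section Norms

variable {a b m : ℕ}

lemma colNorm_nonneg (M : Matrix (Fin a) (Fin b) ℝ) (t : Fin b) : 0 ≤ colNorm M t :=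
  Real.sqrt_nonneg _

lemma colNorm_sq (M : Matrix (Fin a) (Fin b) ℝ) (t : Fin b) :
    colNorm M t ^ 2 = ∑ i, M i t ^ 2 :=
  Real.sq_sqrt (Finset.sum_nonneg fun _ _ => sq_nonneg _)

lemma opNorm_nonneg (M : Matrix (Fin a) (Fin b) ℝ) : 0 ≤ opNorm M := by
  open scoped Matrix.Norms.L2Operator in exact norm_nonneg M

lemma frobSq_eq_sum_colNorm_sq (M : Matrix (Fin a) (Fin b) ℝ) :
    frobSq M = ∑ t, colNorm M t ^ 2 := by
  simp_rw [colNorm_sq, frobSq]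
  exact Finset.sum_comm

lemma continuous_opNorm : Continuous (opNorm : Matrix (Fin a) (Fin b) ℝ → ℝ) := by
  open scoped Matrix.Norms.L2Operator in exact continuous_norm

lemma measurable_opNorm : Measurable (opNorm : Matrix (Fin a) (Fin b) ℝ → ℝ) := by
  have h : Continuous (fun M : Fin a → Fin b → ℝ => opNorm (Matrix.of M)) := continuous_opNorm
  exact h.measurable

lemma opNorm_mul_le (M : Matrix (Fin a) (Fin b) ℝ) (N : Matrix (Fin b) (Fin m) ℝ) :
    opNorm (M * N) ≤ opNorm M * opNorm N := by
  open scoped Matrix.Norms.L2Operator in exact Matrix.l2_opNorm_mul M N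

lemma opNorm_eq_zero {M : Matrix (Fin a) (Fin b) ℝ} (h : opNorm M = 0) : M = 0 := by
  open scoped Matrix.Norms.L2Operator in exact norm_eq_zero.mp h

lemma opNorm_diagonal_le {c : ℝ} (hc : 0 ≤ c) (D : Fin b → ℝ) (hD : ∀ t, |D t| ≤ c) :
    opNorm (Matrix.diagonal D) ≤ c := by
  open scoped Matrix.Norms.L2Operator in
  exact (Matrix.l2_opNorm_diagonal D).le.trans ((pi_norm_le_iff_of_nonneg hc).mpr hD)

lemma norm_toLp_sq (x : Fin a → ℝ) : ‖WithLp.toLp 2 x‖ ^ 2 = ∑ i, x i ^ 2 := by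
  rw [EuclideanSpace.norm_sq_eq]; simp

lemma sum_mulVec_sq_le (M : Matrix (Fin a) (Fin b) ℝ) (w : Fin b → ℝ) :
    ∑ i, M.mulVec w i ^ 2 ≤ opNorm M ^ 2 * ∑ j, w j ^ 2 := by
  open scoped Matrix.Norms.L2Operator in
  have h := Matrix.l2_opNorm_mulVec M (WithLp.toLp 2 w)
  rw [← norm_toLp_sq, ← norm_toLp_sq, ← mul_pow]
  exact pow_le_pow_left₀ (norm_nonneg _) h 2

/-- The operator norm is attained. -/
lemma exists_sum_mulVec_sq_eq (M : Matrix (Fin a) (Fin b) ℝ) :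
    ∃ w : Fin b → ℝ, ∑ j, w j ^ 2 ≤ 1 ∧ opNorm M ^ 2 ≤ ∑ i, M.mulVec w i ^ 2 := by
  open scoped Matrix.Norms.L2Operator in
  let f : EuclideanSpace ℝ (Fin b) → ℝ := fun w => ‖WithLp.toLp 2 (M.mulVec w.ofLp)‖
  have hf : Continuous f := by
    refine continuous_norm.comp ((PiLp.continuous_toLp 2 _).comp ?_)
    exact Continuous.matrix_mulVec continuous_const (PiLp.continuous_ofLp 2 _)
  obtain ⟨w, hw, hmax⟩ := (isCompact_closedBall (0 : EuclideanSpace ℝ (Fin b)) 1).exists_isMaxOn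
    ⟨0, by simp⟩ hf.continuousOn
  refine ⟨w.ofLp, ?_, ?_⟩
  · have : ‖w‖ ≤ 1 := by simpa using hw
    rw [← norm_toLp_sq]
    exact pow_le_one₀ (norm_nonneg _) this
  · rw [← norm_toLp_sq]
    refine pow_le_pow_left₀ (opNorm_nonneg M) ?_ 2
    unfold opNorm
    rw [Matrix.l2_opNorm_def]
    refine ContinuousLinearMap.opNorm_le_of_unit_norm (norm_nonneg _) fun x hx => ?_
    exact hmax (by simp [hx])

/-- The restriction of `M` to identical columns bounds its operator norm from below. -/
lemma card_mul_colNorm_sq_le (M : Matrix (Fin a) (Fin b) ℝ) (T : Finset (Fin b)) (x : Fin a → ℝ)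
    (hT : ∀ t ∈ T, ∀ i, M i t = x i) : (T.card : ℝ) * ∑ i, x i ^ 2 ≤ opNorm M ^ 2 := by
  rcases T.eq_empty_or_nonempty with rfl | hne
  · simp; positivity
  have hpos : 0 < (T.card : ℝ) := by exact_mod_cast hne.card_pos
  have h := sum_mulVec_sq_le M (fun t => if t ∈ T then 1 else 0)
  have h1 : ∀ i, M.mulVec (fun t => if t ∈ T then (1 : ℝ) else 0) i = T.card * x i := fun i => by
    simp only [Matrix.mulVec, dotProduct, mul_ite, mul_one, mul_zero, Finset.sum_ite_mem,
      Finset.univ_inter]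
    rw [Finset.sum_congr rfl fun t ht => hT t ht i]
    simp
  have h2 : ∑ j, (if j ∈ T then (1 : ℝ) else 0) ^ 2 = T.card := by
    simp
  simp_rw [h1, mul_pow, ← Finset.mul_sum] at h
  rw [h2] at h
  refine le_of_mul_le_mul_left ?_ hpos
  linarith

lemma stableRank_le_of {M : Matrix (Fin a) (Fin b) ℝ} {F s r : ℝ} (hF : frobSq M ≤ F)
    (hs : 0 < s) (hM : s ≤ opNorm M ^ 2) (hr : F ≤ r * s) (hr0 : 0 ≤ r) : stableRank M ≤ r := by
  unfold stableRank
  rw [div_le_iff₀ (hs.trans_le hM)]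
  exact hF.trans (hr.trans (by gcongr))

end Norms

-- Normalization and the operator norm

section RMS

variable {d n : ℕ}

lemma colNorm_rmsNorm {X : Matrix (Fin d) (Fin n) ℝ} {t : Fin n} (h : colNorm X t ≠ 0) :
    colNorm (rmsNorm X) t = √(d : ℝ) := by
  have : ∑ i, rmsNorm X i t ^ 2 = d := by
    simp_rw [rmsNorm, Matrix.of_apply, mul_pow, div_pow, ← Finset.mul_sum, ← Finset.sum_div,
      ← colNorm_sq]
    rw [div_self (pow_ne_zero _ h), Real.sq_sqrt (Nat.cast_nonneg _), mul_one]
  rw [colNorm, this]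

/-- Unlike the equality, this holds for vanishing columns too: division by zero returns zero, so
they stay zero. -/
lemma colNorm_rmsNorm_sq_le (X : Matrix (Fin d) (Fin n) ℝ) (t : Fin n) :
    colNorm (rmsNorm X) t ^ 2 ≤ d := by
  by_cases h : colNorm X t = 0
  · rw [colNorm_sq]; simp [rmsNorm, h]
  · rw [colNorm_rmsNorm h, Real.sq_sqrt (Nat.cast_nonneg _)]

lemma frobSq_rmsNorm_le (X : Matrix (Fin d) (Fin n) ℝ) : frobSq (rmsNorm X) ≤ n * d := by
  rw [frobSq_eq_sum_colNorm_sq]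
  refine (Finset.sum_le_sum fun t _ => colNorm_rmsNorm_sq_le X t).trans ?_
  simp

lemma frobSq_rmsNorm {X : Matrix (Fin d) (Fin n) ℝ} (h : ∀ t, colNorm X t ≠ 0) :
    frobSq (rmsNorm X) = n * d := by
  simp [frobSq_eq_sum_colNorm_sq, colNorm_rmsNorm (h _)]

lemma rmsNorm_mul_diagonal (X : Matrix (Fin d) (Fin n) ℝ) :
    rmsNorm X * Matrix.diagonal (fun t => colNorm X t / √(d : ℝ)) = X := by
  ext i t
  rw [Matrix.mul_diagonal, rmsNorm, Matrix.of_apply]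
  have hd : √(d : ℝ) ≠ 0 := by
    have : 0 < d := i.pos
    positivity
  by_cases h : colNorm X t = 0
  · have h0 : ∑ i, X i t ^ 2 = 0 := by rw [← colNorm_sq, h]; simp
    have := (Finset.sum_eq_zero_iff_of_nonneg fun _ _ => sq_nonneg _).mp h0 i (Finset.mem_univ i)
    simp [h, pow_eq_zero_iff two_ne_zero |>.mp this]
  · field_simp

/-- Normalization is undone by right multiplication with the diagonal matrix of rescaled column
norms, whose operator norm is at most `√R`. -/
lemma opNorm_sq_le_rmsNorm (X : Matrix (Fin d) (Fin n) ℝ) {R : ℝ} (hR : 0 ≤ R)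
    (hX : ∀ t, colNorm X t ^ 2 ≤ R * d) : opNorm X ^ 2 ≤ R * opNorm (rmsNorm X) ^ 2 := by
  have h1 : opNorm X ≤ opNorm (rmsNorm X) * √R := by
    conv_lhs => rw [← rmsNorm_mul_diagonal X]
    refine (opNorm_mul_le _ _).trans ?_
    gcongr
    · exact opNorm_nonneg _
    refine opNorm_diagonal_le (Real.sqrt_nonneg _) _ fun t => ?_
    rw [abs_of_nonneg (div_nonneg (colNorm_nonneg _ _) (Real.sqrt_nonneg _))]
    refine div_le_of_le_mul₀ (Real.sqrt_nonneg _) (Real.sqrt_nonneg _) ?_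
    rw [← Real.sqrt_mul hR]
    exact Real.le_sqrt_of_sq_le (hX t)
  calc opNorm X ^ 2 ≤ (opNorm (rmsNorm X) * √R) ^ 2 :=
        pow_le_pow_left₀ (opNorm_nonneg _) h1 2
    _ = _ := by rw [mul_pow, Real.sq_sqrt hR, mul_comm]

/-- Columns of norm at most `√(R d)` and operator norm at least `√s` bound the stable rank of the
normalized matrix. -/
lemma stableRank_rmsNorm_le {X : Matrix (Fin d) (Fin n) ℝ} {R s r : ℝ} (hR : 0 < R) (hs : 0 < s)
    (hX : ∀ t, colNorm X t ^ 2 ≤ R * d) (hop : s ≤ opNorm X ^ 2) (hr0 : 0 ≤ r)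
    (hr : n * d * R ≤ r * s) : stableRank (rmsNorm X) ≤ r := by
  have h := opNorm_sq_le_rmsNorm X hR.le hX
  refine stableRank_le_of (s := s / R) (frobSq_rmsNorm_le X) (by positivity) ?_ ?_ hr0
  · rw [div_le_iff₀ hR]; linarith
  · rw [← mul_div_assoc, le_div_iff₀ hR]; exact hr

end RMS

/-! ### Adding a Gaussian image -/

section Update

variable {a b n : ℕ} {v : ℝ≥0} {δ : ℝ}

lemma sum_sq_eq_zero {x : Fin b → ℝ} (h : ∑ j, x j ^ 2 = 0) : x = 0 := by
  ext j
  have := (Finset.sum_eq_zero_iff_of_nonneg fun _ _ => sq_nonneg _).mp h j (Finset.mem_univ j)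
  exact pow_eq_zero_iff two_ne_zero |>.mp this

lemma rowVariance_pos (hv : v ≠ 0) {z : Fin b → ℝ} (hz : z ≠ 0) : 0 < v * ∑ j, z j ^ 2 := by
  have h0 : 0 ≤ ∑ j, z j ^ 2 := Finset.sum_nonneg fun _ _ => sq_nonneg _
  have h1 : 0 < ∑ j, z j ^ 2 := lt_of_le_of_ne h0 fun h => hz (sum_sq_eq_zero h.symm)
  positivity

lemma measureReal_gaussianMatrix_sq_gt (hv : v ≠ 0) (hδ0 : 0 < δ) (hδ1 : δ ≤ 1) (z : Fin b → ℝ) :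
    (gaussianMatrix a b v).real
        {G | (1 + δ) * (a * v * ∑ j, z j ^ 2) < ∑ i, G.mulVec z i ^ 2}
      ≤ Real.exp (-(δ ^ 2 / 16 * a)) := by
  by_cases hz : z = 0
  · subst hz
    simp [Real.exp_nonneg]
  refine le_trans (measureReal_mono fun G hG => ?_)
    (measureReal_gaussianMatrix_sq_ge v z hδ0 hδ1 (rowVariance_pos hv hz) le_rfl)
  simp only [Set.mem_ofPred_eq] at hG ⊢
  linarith

lemma measureReal_gaussianMatrix_sq_lt (hv : v ≠ 0) (hδ0 : 0 < δ) (z : Fin b → ℝ) :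
    (gaussianMatrix a b v).real
        {G | ∑ i, G.mulVec z i ^ 2 < (1 - δ) * (a * v * ∑ j, z j ^ 2)}
      ≤ Real.exp (-(δ ^ 2 / 16 * a)) := by
  by_cases hz : z = 0
  · subst hz
    simp [Real.exp_nonneg]
  refine le_trans (measureReal_mono fun G hG => ?_)
    (measureReal_gaussianMatrix_sq_le v z hδ0 (rowVariance_pos hv hz))
  simp only [Set.mem_ofPred_eq] at hG ⊢
  linarith

lemma measureReal_gaussianMatrix_bilin_gt (hv : v ≠ 0) (hδ0 : 0 < δ) (y : Fin a → ℝ)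
    (z : Fin b → ℝ) :
    (gaussianMatrix a b v).real
        {G | δ * (√(∑ i, y i ^ 2) * √(a * v * ∑ j, z j ^ 2)) < ∑ i, y i * G.mulVec z i}
      ≤ Real.exp (-(δ ^ 2 / 16 * a)) := by
  by_cases hz : z = 0
  · subst hz
    simp [Real.exp_nonneg]
  by_cases hy : y = 0
  · subst hy
    simp [Real.exp_nonneg]
  have hZ := rowVariance_pos hv hz
  have hY : 0 < ∑ i, y i ^ 2 := by simpa using rowVariance_pos one_ne_zero hy
  refine le_trans (measureReal_mono fun G hG => ?_)
    ((measureReal_gaussianMatrix_bilin_ge v y z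
      (r := δ * (√(∑ i, y i ^ 2) * √(a * v * ∑ j, z j ^ 2))) (by positivity)
      (by positivity)).trans ?_)
  · simp only [Set.mem_ofPred_eq] at hG ⊢
    exact hG.le
  rw [Real.exp_le_exp, mul_pow, mul_pow, Real.sq_sqrt hY.le,
    Real.sq_sqrt (by rw [mul_assoc]; positivity)]
  have : δ ^ 2 * ((∑ i, y i ^ 2) * (a * v * ∑ j, z j ^ 2))
      / (2 * ((∑ i, y i ^ 2) * (v * ∑ j, z j ^ 2))) = δ ^ 2 / 2 * a := by
    have h1 := hY.ne'
    have h2 := right_ne_zero_of_mul hZ.ne'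
    field_simp
  rw [this]
  have : 0 ≤ δ ^ 2 * a := by positivity
  linarith

/-- `‖x'‖²` is close to `‖y‖² + ρ ‖z‖²`. -/
def VecUpdate (δ ρ : ℝ) (y : Fin a → ℝ) (z : Fin b → ℝ) (x' : Fin a → ℝ) : Prop :=
  (1 - 2 * δ) * (∑ i, y i ^ 2 + ρ * ∑ j, z j ^ 2) ≤ ∑ i, x' i ^ 2 ∧
    ∑ i, x' i ^ 2 ≤ ∑ i, y i ^ 2 + 2 * δ * (√(∑ i, y i ^ 2) * √(ρ * ∑ j, z j ^ 2))
      + (1 + δ) * (ρ * ∑ j, z j ^ 2)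

/-- Expanding `‖y + G z‖²`, the four exceptional events are the two tails of `‖G z‖²` and the two
tails of the cross term `⟨y, G z⟩`. -/
lemma measureReal_not_vecUpdate_le (hv : v ≠ 0) (hδ0 : 0 < δ) (hδ1 : δ ≤ 1) (y : Fin a → ℝ)
    (z : Fin b → ℝ) :
    (gaussianMatrix a b v).real {G | ¬ VecUpdate δ (a * v) y z (y + G.mulVec z)}
      ≤ 4 * Real.exp (-(δ ^ 2 / 16 * a)) := by
  set s := {G : Matrix (Fin a) (Fin b) ℝ |
    (1 + δ) * (a * v * ∑ j, z j ^ 2) < ∑ i, G.mulVec z i ^ 2}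
  set s' := {G : Matrix (Fin a) (Fin b) ℝ |
    ∑ i, G.mulVec z i ^ 2 < (1 - δ) * (a * v * ∑ j, z j ^ 2)}
  set r := {G : Matrix (Fin a) (Fin b) ℝ |
    δ * (√(∑ i, y i ^ 2) * √(a * v * ∑ j, z j ^ 2)) < ∑ i, y i * G.mulVec z i}
  set r' := {G : Matrix (Fin a) (Fin b) ℝ |
    δ * (√(∑ i, (-y) i ^ 2) * √(a * v * ∑ j, z j ^ 2)) < ∑ i, (-y) i * G.mulVec z i}
  have hsub : {G | ¬ VecUpdate δ (a * v) y z (y + G.mulVec z)} ⊆ (s ∪ s') ∪ (r ∪ r') := by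
    intro G hG
    by_contra hcon
    simp only [Set.mem_union, not_or, s, s', r, r', Set.mem_ofPred_eq, not_lt, Pi.neg_apply,
      neg_sq, neg_mul, Finset.sum_neg_distrib] at hcon
    obtain ⟨⟨h1, h2⟩, h3, h4⟩ := hcon
    refine hG ?_
    have hexp : ∑ i, (y + G.mulVec z) i ^ 2
        = ∑ i, y i ^ 2 + 2 * ∑ i, y i * G.mulVec z i + ∑ i, G.mulVec z i ^ 2 := by
      rw [Finset.mul_sum, ← Finset.sum_add_distrib, ← Finset.sum_add_distrib]
      exact Finset.sum_congr rfl fun i _ => by simp only [Pi.add_apply]; ring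
    have hY : 0 ≤ ∑ i, y i ^ 2 := Finset.sum_nonneg fun _ _ => sq_nonneg _
    have hZ : 0 ≤ a * v * ∑ j, z j ^ 2 :=
      mul_nonneg (by positivity) (Finset.sum_nonneg fun _ _ => sq_nonneg _)
    -- AM-GM absorbs the cross term in the lower bound only. In the upper bound it would cost a
    -- factor `1 + δ` on `‖y‖²` per update, hence exponential growth in the depth; keeping the
    -- product of norms gives polynomial growth.
    have hamgm := mul_nonneg hδ0.le (sq_nonneg (√(∑ i, y i ^ 2) - √(a * v * ∑ j, z j ^ 2)))
    have e1 := Real.sq_sqrt hY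
    have e2 := Real.sq_sqrt hZ
    rw [sub_sq, e1, e2] at hamgm
    unfold VecUpdate
    rw [hexp]
    constructor
    · have := mul_nonneg hδ0.le hY
      linarith
    · linarith
  calc _ ≤ (gaussianMatrix a b v).real ((s ∪ s') ∪ (r ∪ r')) := measureReal_mono hsub
    _ ≤ ((gaussianMatrix a b v).real s + (gaussianMatrix a b v).real s')
        + ((gaussianMatrix a b v).real r + (gaussianMatrix a b v).real r') :=
        (measureReal_union_le _ _).trans
          (add_le_add (measureReal_union_le _ _) (measureReal_union_le _ _))
    _ ≤ _ := by
        have h1 := measureReal_gaussianMatrix_sq_gt (a := a) hv hδ0 hδ1 z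
        have h2 := measureReal_gaussianMatrix_sq_lt (a := a) hv hδ0 z
        have h3 := measureReal_gaussianMatrix_bilin_gt hv hδ0 y z
        have h4 := measureReal_gaussianMatrix_bilin_gt hv hδ0 (-y) z
        linarith

/-- The matrix version of `VecUpdate`: all columns, and lower bounds for the operator norm. -/
def MatUpdate (δ ρ : ℝ) (Y : Matrix (Fin a) (Fin n) ℝ) (Z : Matrix (Fin b) (Fin n) ℝ)
    (X' : Matrix (Fin a) (Fin n) ℝ) : Prop :=
  (∀ t, VecUpdate δ ρ (fun i => Y i t) (fun j => Z j t) (fun i => X' i t)) ∧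
    (1 - 2 * δ) * opNorm Y ^ 2 ≤ opNorm X' ^ 2 ∧ (1 - 2 * δ) * (ρ * opNorm Z ^ 2) ≤ opNorm X' ^ 2

/-- Only `n + 2` vector updates are needed: the `n` columns, and the images of two vectors at which
`Y` and `Z` attain their operator norms. These vectors are chosen before `G` is drawn. -/
lemma measureReal_not_matUpdate_le (hv : v ≠ 0) (hδ0 : 0 < δ) (hδ1 : δ ≤ 1 / 2)
    (Y : Matrix (Fin a) (Fin n) ℝ) (Z : Matrix (Fin b) (Fin n) ℝ) :
    (gaussianMatrix a b v).real {G | ¬ MatUpdate δ (a * v) Y Z (Y + G * Z)}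
      ≤ (n + 2) * (4 * Real.exp (-(δ ^ 2 / 16 * a))) := by
  obtain ⟨w, hw1, hw⟩ := exists_sum_mulVec_sq_eq Y
  obtain ⟨u, hu1, hu⟩ := exists_sum_mulVec_sq_eq Z
  set S : (Fin n → ℝ) → Set (Matrix (Fin a) (Fin b) ℝ) := fun w =>
    {G | ¬ VecUpdate δ (a * v) (Y.mulVec w) (Z.mulVec w) (Y.mulVec w + G.mulVec (Z.mulVec w))}
  set T : Fin n → Set (Matrix (Fin a) (Fin b) ℝ) := fun t => {G | ¬ VecUpdate δ (a * v)
    (fun i => Y i t) (fun j => Z j t) ((fun i => Y i t) + G.mulVec (fun j => Z j t))}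
  have hop : ∀ (G : Matrix (Fin a) (Fin b) ℝ) (w : Fin n → ℝ), ∑ j, w j ^ 2 ≤ 1 →
      ∑ i, (Y.mulVec w + G.mulVec (Z.mulVec w)) i ^ 2 ≤ opNorm (Y + G * Z) ^ 2 := fun G w hw => by
    have := sum_mulVec_sq_le (Y + G * Z) w
    rw [Matrix.add_mulVec, ← Matrix.mulVec_mulVec] at this
    exact this.trans (mul_le_of_le_one_right (sq_nonneg _) hw)
  have hsub : {G | ¬ MatUpdate δ (a * v) Y Z (Y + G * Z)} ⊆ (⋃ t, T t) ∪ (S w ∪ S u) := by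
    intro G hG
    by_contra hcon
    simp only [Set.mem_union, Set.mem_iUnion, not_or, not_exists, S, T, Set.mem_ofPred_eq,
      not_not] at hcon
    obtain ⟨h1, h2, h3⟩ := hcon
    refine hG ⟨h1, ?_, ?_⟩
    · refine le_trans ?_ (h2.1.trans (hop G w hw1))
      have : 0 ≤ (a * v : ℝ) * ∑ j, (Z.mulVec w) j ^ 2 :=
        mul_nonneg (by positivity) (Finset.sum_nonneg fun _ _ => sq_nonneg _)
      gcongr
      · linarith
      · linarith
    · refine le_trans ?_ (h3.1.trans (hop G u hu1))
      have : 0 ≤ ∑ j, (Y.mulVec u) j ^ 2 := Finset.sum_nonneg fun _ _ => sq_nonneg _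
      have h4 : (a * v : ℝ) * opNorm Z ^ 2 ≤ a * v * ∑ j, (Z.mulVec u) j ^ 2 := by gcongr
      gcongr
      · linarith
      · linarith
  have hδ1' : δ ≤ 1 := by linarith
  calc _ ≤ (gaussianMatrix a b v).real ((⋃ t, T t) ∪ (S w ∪ S u)) := measureReal_mono hsub
    _ ≤ ∑ t, (gaussianMatrix a b v).real (T t)
        + ((gaussianMatrix a b v).real (S w) + (gaussianMatrix a b v).real (S u)) :=
        (measureReal_union_le _ _).trans
          (add_le_add (measureReal_iUnion_fintype_le _) (measureReal_union_le _ _))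
    _ ≤ ∑ _t : Fin n, 4 * Real.exp (-(δ ^ 2 / 16 * a))
        + (4 * Real.exp (-(δ ^ 2 / 16 * a)) + 4 * Real.exp (-(δ ^ 2 / 16 * a))) := by
        gcongr
        · exact measureReal_not_vecUpdate_le hv hδ0 hδ1' _ _
        · exact measureReal_not_vecUpdate_le hv hδ0 hδ1' _ _
        · exact measureReal_not_vecUpdate_le hv hδ0 hδ1' _ _
    _ = _ := by simp; ring

end Update

/-! ### Measurability -/

section Measurability

variable {α : Type*} [MeasurableSpace α] {a b m : ℕ}

lemma measurableSet_forall {ι : Type*} [Countable ι] {p : ι → α → Prop}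
    (h : ∀ i, MeasurableSet {x | p i x}) : MeasurableSet {x | ∀ i, p i x} := by
  rw [Set.ofPred_forall]
  exact MeasurableSet.iInter h

lemma measurableSet_and {p q : α → Prop} (hp : MeasurableSet {x | p x})
    (hq : MeasurableSet {x | q x}) : MeasurableSet {x | p x ∧ q x} := hp.inter hq

lemma measurableSet_not {p : α → Prop} (hp : MeasurableSet {x | p x}) :
    MeasurableSet {x | ¬ p x} := hp.compl

lemma measurable_matrix {ι κ : Type*} {f : α → Matrix ι κ ℝ}
    (h : ∀ i j, Measurable fun x => f x i j) : Measurable f :=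
  measurable_pi_iff.mpr fun i => measurable_pi_iff.mpr (h i)

lemma measurable_entry {ι κ : Type*} {f : α → Matrix ι κ ℝ} (hf : Measurable f) (i : ι) (j : κ) :
    Measurable fun x => f x i j :=
  measurable_pi_iff.mp (measurable_pi_iff.mp hf i) j

lemma measurable_matrix_mul {f : α → Matrix (Fin a) (Fin b) ℝ} {g : α → Matrix (Fin b) (Fin m) ℝ}
    (hf : Measurable f) (hg : Measurable g) : Measurable fun x => f x * g x := by
  refine measurable_matrix fun i j => ?_
  simp only [Matrix.mul_apply]
  exact Finset.measurable_sum _ fun l _ => (measurable_entry hf i l).mul (measurable_entry hg l j)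

lemma measurable_matrix_add {f g : α → Matrix (Fin a) (Fin b) ℝ}
    (hf : Measurable f) (hg : Measurable g) : Measurable fun x => f x + g x :=
  measurable_matrix fun i j => (measurable_entry hf i j).add (measurable_entry hg i j)

lemma measurable_colNorm {f : α → Matrix (Fin a) (Fin b) ℝ} (hf : Measurable f) (t : Fin b) :
    Measurable fun x => colNorm (f x) t :=
  (Finset.measurable_sum _ fun i _ => (measurable_entry hf i t).pow_const 2).sqrt

lemma measurable_rmsNorm {f : α → Matrix (Fin a) (Fin b) ℝ} (hf : Measurable f) :
    Measurable fun x => rmsNorm (f x) :=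
  measurable_matrix fun i t =>
    ((measurable_entry hf i t).div (measurable_colNorm hf t)).const_mul _

lemma measurable_frobSq {f : α → Matrix (Fin a) (Fin b) ℝ} (hf : Measurable f) :
    Measurable fun x => frobSq (f x) :=
  Finset.measurable_sum _ fun i _ => Finset.measurable_sum _ fun j _ =>
    (measurable_entry hf i j).pow_const 2

lemma measurable_stableRank {f : α → Matrix (Fin a) (Fin b) ℝ} (hf : Measurable f) :
    Measurable fun x => stableRank (f x) :=
  (measurable_frobSq hf).div ((measurable_opNorm.comp hf).pow_const 2)

lemma measurable_matrix_map {f : α → Matrix (Fin a) (Fin b) ℝ} (hf : Measurable f) {σ : ℝ → ℝ}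
    (hσ : Measurable σ) : Measurable fun x => (f x).map σ :=
  measurable_matrix fun i j => hσ.comp (measurable_entry hf i j)

lemma measurableSet_columnStochastic {f : α → Matrix (Fin a) (Fin a) ℝ} (hf : Measurable f) :
    MeasurableSet {x | ColumnStochastic (f x)} := by
  refine measurableSet_and ?_ ?_
  · refine measurableSet_forall fun i => measurableSet_forall fun t => ?_
    exact measurableSet_le measurable_const (measurable_entry hf i t)
  · refine measurableSet_forall fun t => ?_
    exact measurableSet_eq_fun (Finset.measurable_sum _ fun i _ => measurable_entry hf i t)
      measurable_const

lemma measurableSet_matUpdate (δ ρ : ℝ) {Y X' : α → Matrix (Fin a) (Fin m) ℝ}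
    {Z : α → Matrix (Fin b) (Fin m) ℝ} (hY : Measurable Y) (hZ : Measurable Z)
    (hX' : Measurable X') : MeasurableSet {x | MatUpdate δ ρ (Y x) (Z x) (X' x)} := by
  have hsum : ∀ {c : ℕ} {f : α → Matrix (Fin c) (Fin m) ℝ}, Measurable f → ∀ t,
      Measurable fun x => ∑ i, f x i t ^ 2 := fun hf t =>
    Finset.measurable_sum _ fun i _ => (measurable_entry hf i t).pow_const 2
  refine measurableSet_and (measurableSet_forall fun t => ?_) (measurableSet_and ?_ ?_)
  · have h1 := hsum hY t
    have h2 := hsum hZ t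
    have h3 := hsum hX' t
    exact measurableSet_and (measurableSet_le (by fun_prop) h3)
      (measurableSet_le h3 (by fun_prop))
  · exact measurableSet_le (((measurable_opNorm.comp hY).pow_const 2).const_mul _)
      ((measurable_opNorm.comp hX').pow_const 2)
  · exact measurableSet_le ((((measurable_opNorm.comp hZ).pow_const 2).const_mul _).const_mul _)
      ((measurable_opNorm.comp hX').pow_const 2)

end Measurability

/-! ### One layer -/

namespace Layer

variable {d nHead dHead k n : ℕ}

/-- The concatenated head outputs. -/
def heads (θ : Layer d nHead dHead k n) (hd : d = nHead * dHead) (X : Matrix (Fin d) (Fin n) ℝ) :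
    Matrix (Fin d) (Fin n) ℝ :=
  concatHeads hd fun h => θ.WV h * (rmsNorm X * θ.P h)

/-- The layer with the given mixing matrices and weights. -/
def mk' (P : Fin nHead → Matrix (Fin n) (Fin n) ℝ) (w : WeightSpace d nHead dHead k) :
    Layer d nHead dHead k n := ⟨P, w.1, w.2.1, w.2.2.1, w.2.2.2⟩

section Measurable

variable {α : Type*} [MeasurableSpace α] {P : α → Fin nHead → Matrix (Fin n) (Fin n) ℝ}
  {w : α → WeightSpace d nHead dHead k} {X : α → Matrix (Fin d) (Fin n) ℝ}

lemma measurable_heads (hd : d = nHead * dHead) (hP : Measurable P) (hw : Measurable w)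
    (hX : Measurable X) : Measurable fun x => (mk' (P x) (w x)).heads hd (X x) := by
  refine measurable_matrix fun i t => ?_
  exact measurable_entry (measurable_matrix_mul ((measurable_pi_apply _).comp hw.fst)
    (measurable_matrix_mul (measurable_rmsNorm hX) ((measurable_pi_apply _).comp hP))) _ _

lemma measurable_att (hd : d = nHead * dHead) (hP : Measurable P) (hw : Measurable w)
    (hX : Measurable X) : Measurable fun x => (mk' (P x) (w x)).att hd (X x) :=
  measurable_matrix_add hX (measurable_matrix_mul hw.snd.fst (measurable_heads hd hP hw hX))

lemma measurable_postAct (hd : d = nHead * dHead) {σ : ℝ → ℝ} (hσ : Measurable σ)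
    (hP : Measurable P) (hw : Measurable w) (hX : Measurable X) :
    Measurable fun x => (mk' (P x) (w x)).postAct hd σ (X x) :=
  measurable_matrix_map (measurable_matrix_mul hw.snd.snd.fst
    (measurable_rmsNorm (measurable_att hd hP hw hX))) hσ

lemma measurable_out (hd : d = nHead * dHead) {σ : ℝ → ℝ} (hσ : Measurable σ)
    (hP : Measurable P) (hw : Measurable w) (hX : Measurable X) :
    Measurable fun x => (mk' (P x) (w x)).out hd σ (X x) :=
  measurable_matrix_add (measurable_att hd hP hw hX)
    (measurable_matrix_mul hw.snd.snd.snd (measurable_postAct hd hσ hP hw hX))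

end Measurable

/-- The concentration properties of one layer. -/
structure Concentrated (θ : Layer d nHead dHead k n) (hd : d = nHead * dHead) (σ : ℝ → ℝ)
    (δ stσ pσ : ℝ) (X : Matrix (Fin d) (Fin n) ℝ) : Prop where
  heads : ∀ t, colNorm (θ.heads hd X) t ^ 2 ≤ (1 + δ) * d
  att : MatUpdate δ 1 X (θ.heads hd X) (θ.att hd X)
  spike : stableRank (θ.postAct hd σ X) ≤ stσ ∧
    (k : ℝ) * pσ / d * frobSq (rmsNorm (θ.att hd X)) ≤ frobSq (θ.postAct hd σ X)
  postAct : ∀ t, colNorm (θ.postAct hd σ X) t ^ 2 ≤ (1 + δ) * k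
  out : MatUpdate δ (d / k) (θ.att hd X) (θ.postAct hd σ X) (θ.out hd σ X)

end Layer

lemma sum_concatHeads_sq {d nHead dHead n : ℕ} (hd : d = nHead * dHead)
    (H : Fin nHead → Matrix (Fin dHead) (Fin n) ℝ) (t : Fin n) :
    ∑ i, concatHeads hd H i t ^ 2 = ∑ h, ∑ r, H h r t ^ 2 := by
  rw [← Fintype.sum_prod_type' (fun h r => H h r t ^ 2)]
  exact Fintype.sum_equiv ((finCongr hd).trans finProdFinEquiv.symm) _ _ fun i => rfl

/-- Each column of `A * P` is a convex combination of columns of `A`, and squaring is convex. -/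
lemma sum_mul_columnStochastic_sq_le {d n : ℕ} {A : Matrix (Fin d) (Fin n) ℝ} {c : ℝ}
    (hA : ∀ t, colNorm A t ^ 2 ≤ c) {P : Matrix (Fin n) (Fin n) ℝ} (hP : ColumnStochastic P)
    (t : Fin n) : ∑ j, (A * P) j t ^ 2 ≤ c := by
  have h1 : ∀ j, (A * P) j t ^ 2 ≤ ∑ s, P s t * A j s ^ 2 := fun j => by
    have := (even_two.convexOn_pow (𝕜 := ℝ)).map_sum_le (t := Finset.univ)
      (w := fun s => P s t) (p := fun s => A j s) (fun s _ => hP.1 s t) (hP.2 t)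
      (fun _ _ => Set.mem_univ _)
    simpa [Matrix.mul_apply, mul_comm] using this
  calc _ ≤ ∑ j, ∑ s, P s t * A j s ^ 2 := Finset.sum_le_sum fun j _ => h1 j
    _ = ∑ s, P s t * colNorm A s ^ 2 := by
        rw [Finset.sum_comm]
        simp_rw [colNorm_sq, Finset.mul_sum]
    _ ≤ ∑ s, P s t * c := Finset.sum_le_sum fun s _ =>
        mul_le_mul_of_nonneg_left (hA s) (hP.1 s t)
    _ = c := by rw [← Finset.sum_mul, hP.2 t, one_mul]

-- Freezing variables in a product measure

section Fubini

variable {α β : Type*} [MeasurableSpace α] [MeasurableSpace β] {μ : Measure α} {ν : Measure β}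
  [IsProbabilityMeasure μ] [IsProbabilityMeasure ν]

lemma measureReal_le_iff_le_ofReal {S : Set α} {ε : ℝ} (hε : 0 ≤ ε) :
    μ.real S ≤ ε ↔ μ S ≤ ENNReal.ofReal ε := by
  rw [measureReal_def, ENNReal.le_ofReal_iff_toReal_le (measure_ne_top _ _) hε]

/-- A bound uniform over slices integrates to the same bound. Together with its mirror image this
peels off the weight matrices until only the relevant one is random. -/
lemma measureReal_prod_le_of_right {S : Set (α × β)} (hS : MeasurableSet S) {ε : ℝ} (hε : 0 ≤ ε)
    (h : ∀ x, ν.real {y | (x, y) ∈ S} ≤ ε) : (μ.prod ν).real S ≤ ε := by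
  rw [measureReal_le_iff_le_ofReal hε, Measure.prod_apply hS]
  calc _ ≤ ∫⁻ _, ENNReal.ofReal ε ∂μ :=
        lintegral_mono fun x => (measureReal_le_iff_le_ofReal hε).mp (h x)
    _ = _ := by simp

lemma measureReal_prod_le_of_left {S : Set (α × β)} (hS : MeasurableSet S) {ε : ℝ} (hε : 0 ≤ ε)
    (h : ∀ y, μ.real {x | (x, y) ∈ S} ≤ ε) : (μ.prod ν).real S ≤ ε := by
  rw [measureReal_le_iff_le_ofReal hε, Measure.prod_apply_symm hS]
  calc _ ≤ ∫⁻ _, ENNReal.ofReal ε ∂ν :=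
        lintegral_mono fun x => (measureReal_le_iff_le_ofReal hε).mp (h x)
    _ = _ := by simp

end Fubini

instance isProbabilityMeasure_weightLaw (d nHead dHead k : ℕ) :
    IsProbabilityMeasure (weightLaw d nHead dHead k) := by
  unfold weightLaw; infer_instance

-- Failure probabilities within one layer

section LayerBound

variable {d nHead dHead k n : ℕ} (hd : d = nHead * dHead) {σ : ℝ → ℝ} {δ stσ pσ : ℝ}
  {Psucc : ℕ → ℕ → ℕ → ℝ} {X : Matrix (Fin d) (Fin n) ℝ}
  {P : Fin nHead → Matrix (Fin n) (Fin n) ℝ}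

lemma MeanSpike.abs_le (h : MeanSpike σ stσ pσ Psucc) (x : ℝ) : |σ x| ≤ |x| := by
  simpa [h.map_zero] using h.lipschitz.dist_le_mul x 0

/-- Column `t` stacks the vectors `W_h u_h`, where `u_h` is column `t` of `rmsNorm X * P h`.
Convexity gives `‖u_h‖² ≤ d`, so all `d` coordinates are independent Gaussians of variance at most
one. -/
lemma weightLaw_heads_le (hδ0 : 0 < δ) (hδ1 : δ ≤ 1) (hd1 : 1 ≤ d)
    (hP : ∀ h, ColumnStochastic (P h)) :
    (weightLaw d nHead dHead k).real
        {w | ¬ ∀ t, colNorm ((Layer.mk' P w).heads hd X) t ^ 2 ≤ (1 + δ) * d}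
      ≤ n * Real.exp (-(δ ^ 2 / 16 * d)) := by
  have hmeas := Layer.measurable_heads (k := k) (P := fun _ => P) (w := id) (X := fun _ => X) hd
    measurable_const measurable_id measurable_const
  refine measureReal_prod_le_of_left ?_ (by positivity) fun w' => ?_
  · refine measurableSet_not (measurableSet_forall fun t => ?_)
    exact measurableSet_le ((measurable_colNorm hmeas t).pow_const 2) measurable_const
  set T : Fin n → Set (Fin nHead → Matrix (Fin dHead) (Fin d) ℝ) := fun t =>
    {W | (1 + δ) * (nHead * dHead : ℕ) * 1
      ≤ ∑ h, ∑ i, (W h).mulVec (fun j => (rmsNorm X * P h) j t) i ^ 2}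
  have hsub : {V | (V, w') ∈ {w : WeightSpace d nHead dHead k |
      ¬ ∀ t, colNorm ((Layer.mk' P w).heads hd X) t ^ 2 ≤ (1 + δ) * d}} ⊆ ⋃ t, T t := by
    intro V hV
    simp only [Set.mem_ofPred_eq, not_forall, not_le] at hV
    obtain ⟨t, ht⟩ := hV
    refine Set.mem_iUnion.mpr ⟨t, ?_⟩
    rw [colNorm_sq, Layer.heads, sum_concatHeads_sq] at ht
    have e : ((nHead * dHead : ℕ) : ℝ) = d := by rw [← hd]
    simp only [T, Set.mem_ofPred_eq, mul_one, e]
    exact ht.le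
  calc _ ≤ _ := measureReal_mono hsub
    _ ≤ ∑ t, _ := measureReal_iUnion_fintype_le _
    _ ≤ ∑ _t : Fin n, Real.exp (-(δ ^ 2 / 16 * (nHead * dHead : ℕ))) := by
        refine Finset.sum_le_sum fun t _ => ?_
        refine measureReal_pi_gaussianMatrix_sq_ge _ _ hδ0 hδ1 one_pos fun h => ?_
        have := sum_mul_columnStochastic_sq_le (colNorm_rmsNorm_sq_le X) (hP h) t
        have hd0 : 0 < (d : ℝ) := by exact_mod_cast hd1
        push_cast
        rw [inv_mul_le_iff₀ hd0]
        linarith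
    _ = _ := by rw [← hd]; simp

lemma weightLaw_att_le (hδ0 : 0 < δ) (hδ1 : δ ≤ 1 / 2) (hd1 : 1 ≤ d) :
    (weightLaw d nHead dHead k).real
        {w | ¬ MatUpdate δ 1 X ((Layer.mk' P w).heads hd X) ((Layer.mk' P w).att hd X)}
      ≤ (n + 2) * (4 * Real.exp (-(δ ^ 2 / 16 * d))) := by
  have hd0 : (d : ℝ) ≠ 0 := by positivity
  have hS : MeasurableSet {w : WeightSpace d nHead dHead k |
      ¬ MatUpdate δ 1 X ((Layer.mk' P w).heads hd X) ((Layer.mk' P w).att hd X)} :=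
    measurableSet_not (measurableSet_matUpdate δ 1 measurable_const
      (Layer.measurable_heads hd measurable_const measurable_id measurable_const)
      (Layer.measurable_att hd measurable_const measurable_id measurable_const))
  refine measureReal_prod_le_of_right hS (by positivity) fun V => ?_
  refine measureReal_prod_le_of_left (measurable_prodMk_left hS) (by positivity) fun w' => ?_
  have := measureReal_not_matUpdate_le (a := d) (v := (d : ℝ≥0)⁻¹)
    (inv_ne_zero (by exact_mod_cast hd0)) hδ0 hδ1 X
    (concatHeads hd fun h => V h * (rmsNorm X * P h))
  push_cast at this
  rw [mul_inv_cancel₀ hd0] at this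
  exact this

/-- The assumption on `σ` requires equal column norms, which normalization provides only when no
column vanishes; hence nonvanishing is part of the event. -/
lemma weightLaw_spike_le (hspike : MeanSpike σ stσ pσ Psucc) (hd1 : 1 ≤ d) (hk1 : 1 ≤ k)
    (hn1 : 1 ≤ n) :
    (weightLaw d nHead dHead k).real
        {w | (∀ t, colNorm ((Layer.mk' P w).att hd X) t ≠ 0) ∧
          ¬ (stableRank ((Layer.mk' P w).postAct hd σ X) ≤ stσ ∧
            (k : ℝ) * pσ / d * frobSq (rmsNorm ((Layer.mk' P w).att hd X))
              ≤ frobSq ((Layer.mk' P w).postAct hd σ X))}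
      ≤ 1 - Psucc d k n := by
  have hσ : Measurable σ := hspike.lipschitz.continuous.measurable
  -- `Psucc` is not assumed to be a probability; testing the assumption on the zero matrix bounds it
  -- by one.
  have hP1 : Psucc d k n ≤ 1 :=
    (hspike.bound d k n hd1 hk1 hn1 0 fun s t => by simp [colNorm]).trans measureReal_le_one
  have hatt := Layer.measurable_att (P := fun _ => P) (w := id) (X := fun _ => X) (k := k) hd
    measurable_const measurable_id measurable_const
  have hact := Layer.measurable_postAct (P := fun _ => P) (w := id) (X := fun _ => X) (k := k) hd hσ
    measurable_const measurable_id measurable_const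
  have hS : MeasurableSet {w : WeightSpace d nHead dHead k |
      (∀ t, colNorm ((Layer.mk' P w).att hd X) t ≠ 0) ∧
          ¬ (stableRank ((Layer.mk' P w).postAct hd σ X) ≤ stσ ∧
            (k : ℝ) * pσ / d * frobSq (rmsNorm ((Layer.mk' P w).att hd X))
              ≤ frobSq ((Layer.mk' P w).postAct hd σ X))} := by
    refine measurableSet_and (measurableSet_forall fun t => ?_)
      (measurableSet_not (measurableSet_and ?_ ?_))
    · exact (measurableSet_eq_fun (measurable_colNorm hatt t) measurable_const).compl
    · exact measurableSet_le (measurable_stableRank hact) measurable_const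
    · exact measurableSet_le ((measurable_frobSq (measurable_rmsNorm hatt)).const_mul _)
        (measurable_frobSq hact)
  have h0 : 0 ≤ 1 - Psucc d k n := by linarith
  refine measureReal_prod_le_of_right hS h0 fun V => ?_
  have hS1 := measurable_prodMk_left (x := V) hS
  refine measureReal_prod_le_of_right hS1 h0 fun O => ?_
  have hS2 := measurable_prodMk_left (x := O) hS1
  refine measureReal_prod_le_of_left hS2 h0 fun W2 => ?_
  set Y : Matrix (Fin d) (Fin n) ℝ := X + O * concatHeads hd fun h => V h * (rmsNorm X * P h)
  by_cases hY : ∀ t, colNorm Y t ≠ 0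
  · set S := {W : Matrix (Fin k) (Fin d) ℝ | stableRank ((W * rmsNorm Y).map σ) ≤ stσ ∧
        (k : ℝ) * pσ / d * frobSq (rmsNorm Y) ≤ frobSq ((W * rmsNorm Y).map σ)} with hSdef
    have hb := hspike.bound d k n hd1 hk1 hn1 (rmsNorm Y)
      fun s t => by rw [colNorm_rmsNorm (hY s), colNorm_rmsNorm (hY t)]
    have hSm : MeasurableSet S := by
      have : Measurable fun W : Matrix (Fin k) (Fin d) ℝ => (W * rmsNorm Y).map σ :=
        measurable_matrix_map (measurable_matrix_mul measurable_id measurable_const) hσ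
      exact (measurableSet_le (measurable_stableRank this) measurable_const).inter
        (measurableSet_le measurable_const (measurable_frobSq this))
    have hc : (gaussianMatrix k d (d : ℝ≥0)⁻¹).real Sᶜ ≤ 1 - Psucc d k n := by
      rw [probReal_compl_eq_one_sub hSm]
      linarith
    refine le_trans (measureReal_mono fun W hW => ?_) hc
    exact hW.2
  · refine le_trans (le_of_eq ?_) h0
    convert measureReal_empty
    refine Set.eq_empty_of_forall_notMem fun W hW => hY hW.1

lemma weightLaw_postAct_le (hspike : MeanSpike σ stσ pσ Psucc) (hδ0 : 0 < δ) (hδ1 : δ ≤ 1)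
    (hd1 : 1 ≤ d) :
    (weightLaw d nHead dHead k).real
        {w | ¬ ∀ t, colNorm ((Layer.mk' P w).postAct hd σ X) t ^ 2 ≤ (1 + δ) * k}
      ≤ n * Real.exp (-(δ ^ 2 / 16 * k)) := by
  have hσ : Measurable σ := hspike.lipschitz.continuous.measurable
  have hact := Layer.measurable_postAct (P := fun _ => P) (w := id) (X := fun _ => X) (k := k) hd hσ
    measurable_const measurable_id measurable_const
  have hS : MeasurableSet {w : WeightSpace d nHead dHead k |
      ¬ ∀ t, colNorm ((Layer.mk' P w).postAct hd σ X) t ^ 2 ≤ (1 + δ) * k} := by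
    refine measurableSet_not (measurableSet_forall fun t => ?_)
    exact measurableSet_le ((measurable_colNorm hact t).pow_const 2) measurable_const
  refine measureReal_prod_le_of_right hS (by positivity) fun V => ?_
  have hS1 := measurable_prodMk_left (x := V) hS
  refine measureReal_prod_le_of_right hS1 (by positivity) fun O => ?_
  have hS2 := measurable_prodMk_left (x := O) hS1
  refine measureReal_prod_le_of_left hS2 (by positivity) fun W2 => ?_
  set A : Matrix (Fin d) (Fin n) ℝ :=
    rmsNorm (X + O * concatHeads hd fun h => V h * (rmsNorm X * P h))
  set T : Fin n → Set (Matrix (Fin k) (Fin d) ℝ) := fun t =>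
    {W | (1 + δ) * k * 1 ≤ ∑ i, W.mulVec (fun j => A j t) i ^ 2}
  refine le_trans (measureReal_mono (s₂ := ⋃ t, T t) fun W hW => ?_) ?_
  · have hW : ¬ ∀ t, colNorm ((W * A).map σ) t ^ 2 ≤ (1 + δ) * k := hW
    simp only [not_forall, not_le] at hW
    obtain ⟨t, ht⟩ := hW
    refine Set.mem_iUnion.mpr ⟨t, ?_⟩
    rw [colNorm_sq] at ht
    simp only [T, Set.mem_ofPred_eq, mul_one]
    refine ht.le.trans (Finset.sum_le_sum fun i _ => ?_)
    -- Since `|σ x| ≤ |x|`, the activation only shrinks the columns of `W * A`.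
    exact sq_le_sq.mpr (hspike.abs_le _)
  · calc _ ≤ ∑ t, _ := measureReal_iUnion_fintype_le _
      _ ≤ ∑ _t : Fin n, Real.exp (-(δ ^ 2 / 16 * k)) := by
        refine Finset.sum_le_sum fun t _ => ?_
        refine measureReal_gaussianMatrix_sq_ge _ _ hδ0 hδ1 one_pos ?_
        have hd0 : 0 < (d : ℝ) := by exact_mod_cast hd1
        push_cast
        rw [inv_mul_le_iff₀ hd0, ← colNorm_sq, mul_one]
        exact colNorm_rmsNorm_sq_le _ t
      _ = _ := by simp

lemma weightLaw_out_le (hσ : Measurable σ) (hδ0 : 0 < δ) (hδ1 : δ ≤ 1 / 2) (hk1 : 1 ≤ k) :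
    (weightLaw d nHead dHead k).real
        {w | ¬ MatUpdate δ (d / k) ((Layer.mk' P w).att hd X) ((Layer.mk' P w).postAct hd σ X)
          ((Layer.mk' P w).out hd σ X)}
      ≤ (n + 2) * (4 * Real.exp (-(δ ^ 2 / 16 * d))) := by
  have hk0 : (k : ℝ) ≠ 0 := by positivity
  have hS : MeasurableSet {w : WeightSpace d nHead dHead k |
      ¬ MatUpdate δ (d / k) ((Layer.mk' P w).att hd X) ((Layer.mk' P w).postAct hd σ X)
          ((Layer.mk' P w).out hd σ X)} :=
    measurableSet_not (measurableSet_matUpdate δ _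
      (Layer.measurable_att hd measurable_const measurable_id measurable_const)
      (Layer.measurable_postAct hd hσ measurable_const measurable_id measurable_const)
      (Layer.measurable_out hd hσ measurable_const measurable_id measurable_const))
  refine measureReal_prod_le_of_right hS (by positivity) fun V => ?_
  have hS1 := measurable_prodMk_left (x := V) hS
  refine measureReal_prod_le_of_right hS1 (by positivity) fun O => ?_
  have hS2 := measurable_prodMk_left (x := O) hS1
  refine measureReal_prod_le_of_right hS2 (by positivity) fun W1 => ?_
  set Y : Matrix (Fin d) (Fin n) ℝ := X + O * concatHeads hd fun h => V h * (rmsNorm X * P h)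
  have := measureReal_not_matUpdate_le (a := d) (v := (k : ℝ≥0)⁻¹)
    (inv_ne_zero (by exact_mod_cast hk0)) hδ0 hδ1 Y ((W1 * rmsNorm Y).map σ)
  push_cast at this
  rw [← div_eq_mul_inv] at this
  exact this

/-- The factor `1 - 2δ` in the lower bound is positive, so nonvanishing columns survive an update.
-/
lemma MatUpdate.colNorm_ne_zero {a b : ℕ} {ρ : ℝ} (hδ1 : δ < 1 / 2) (hρ : 0 ≤ ρ)
    {Y X' : Matrix (Fin a) (Fin n) ℝ} {Z : Matrix (Fin b) (Fin n) ℝ} (h : MatUpdate δ ρ Y Z X')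
    {t : Fin n} (hY : colNorm Y t ≠ 0) : colNorm X' t ≠ 0 := by
  have h1 := (h.1 t).1
  simp only [← colNorm_sq] at h1
  intro h0
  rw [h0] at h1
  have : 0 < colNorm Y t ^ 2 := by positivity
  have h2 : 0 ≤ ρ * colNorm Z t ^ 2 := by positivity
  nlinarith

/-- A layer is concentrated with high probability, whatever its input and mixing matrices. -/
lemma weightLaw_not_concentrated_le (hspike : MeanSpike σ stσ pσ Psucc) (hδ0 : 0 < δ)
    (hδ1 : δ < 1 / 2) (hd1 : 1 ≤ d) (hk1 : 1 ≤ k) (hn1 : 1 ≤ n) (hX : ∀ t, colNorm X t ≠ 0)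
    (hP : ∀ h, ColumnStochastic (P h)) :
    (weightLaw d nHead dHead k).real {w | ¬ (Layer.mk' P w).Concentrated hd σ δ stσ pσ X}
      ≤ 25 * n * Real.exp (-(δ ^ 2 / 16 * d)) + n * Real.exp (-(δ ^ 2 / 16 * k))
        + (1 - Psucc d k n) := by
  have hσ : Measurable σ := hspike.lipschitz.continuous.measurable
  have h1 := weightLaw_heads_le (k := k) (X := X) hd hδ0 (by linarith) hd1 hP
  have h2 := weightLaw_att_le (k := k) (X := X) (P := P) hd hδ0 hδ1.le hd1
  have h3 := weightLaw_spike_le (X := X) (P := P) hd hspike hd1 hk1 hn1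
  have h4 := weightLaw_postAct_le (k := k) (X := X) (P := P) hd hspike hδ0 (by linarith) hd1
  have h5 := weightLaw_out_le (X := X) (P := P) hd hσ hδ0 hδ1.le hk1
  set s1 := {w : WeightSpace d nHead dHead k | ¬ ∀ t, colNorm ((Layer.mk' P w).heads hd X) t ^ 2
    ≤ (1 + δ) * d}
  set s2 := {w : WeightSpace d nHead dHead k | ¬ MatUpdate δ 1 X ((Layer.mk' P w).heads hd X)
    ((Layer.mk' P w).att hd X)}
  set s3 := {w : WeightSpace d nHead dHead k | (∀ t, colNorm ((Layer.mk' P w).att hd X) t ≠ 0) ∧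
          ¬ (stableRank ((Layer.mk' P w).postAct hd σ X) ≤ stσ ∧
            (k : ℝ) * pσ / d * frobSq (rmsNorm ((Layer.mk' P w).att hd X))
              ≤ frobSq ((Layer.mk' P w).postAct hd σ X))}
  set s4 := {w : WeightSpace d nHead dHead k |
    ¬ ∀ t, colNorm ((Layer.mk' P w).postAct hd σ X) t ^ 2 ≤ (1 + δ) * k}
  set s5 := {w : WeightSpace d nHead dHead k | ¬ MatUpdate δ (d / k) ((Layer.mk' P w).att hd X)
    ((Layer.mk' P w).postAct hd σ X) ((Layer.mk' P w).out hd σ X)}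
  have hsub : {w | ¬ (Layer.mk' P w).Concentrated hd σ δ stσ pσ X}
      ⊆ s1 ∪ (s2 ∪ (s3 ∪ (s4 ∪ s5))) := by
    intro w hw
    by_contra hcon
    simp only [Set.mem_union, not_or, s1, s2, s3, s4, s5, Set.mem_ofPred_eq, not_not,
      not_and] at hcon
    obtain ⟨c1, c2, c3, c4, c5⟩ := hcon
    have hne : ∀ t, colNorm ((Layer.mk' P w).att hd X) t ≠ 0 := fun t =>
      c2.colNorm_ne_zero hδ1 zero_le_one (hX t)
    exact hw ⟨c1, c2, by simpa using c3 hne, c4, c5⟩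
  have hn : (1 : ℝ) ≤ n := by exact_mod_cast hn1
  set μ := weightLaw d nHead dHead k
  have hu : μ.real (s1 ∪ (s2 ∪ (s3 ∪ (s4 ∪ s5))))
      ≤ μ.real s1 + (μ.real s2 + (μ.real s3 + (μ.real s4 + μ.real s5))) := by
    refine (measureReal_union_le _ _).trans (add_le_add le_rfl ?_)
    refine (measureReal_union_le _ _).trans (add_le_add le_rfl ?_)
    exact (measureReal_union_le _ _).trans (add_le_add le_rfl (measureReal_union_le _ _))
  have hm : μ.real {w | ¬ (Layer.mk' P w).Concentrated hd σ δ stσ pσ X} ≤ _ := measureReal_mono hsub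
  -- The terms in `d` total `n + 8 (n + 2) = 9 n + 16`, which is at most `25 n` because `n ≥ 1`.
  have he := mul_le_mul_of_nonneg_right hn (Real.exp_nonneg (-(δ ^ 2 / 16 * d)))
  linarith

end LayerBound

/-! ### Consequences of concentration -/

/-- With `δ = 1/500` the cross term costs `2δ(1 + δ) s ≤ 0.005 s` and the increment costs `(1 + δ)²
≤ 1.005`. The bound `q` on the square and the bound `s` on the norm are separate because `q` need
not be a convenient square. -/
lemma MatUpdate.colNorm_sq_le {a b d n : ℕ} {ρ q s : ℝ} {Y X' : Matrix (Fin a) (Fin n) ℝ}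
    {Z : Matrix (Fin b) (Fin n) ℝ} (h : MatUpdate (1 / 500) ρ Y Z X') (hs : 0 ≤ s) (hqs : q ≤ s ^ 2)
    {t : Fin n} (hY : colNorm Y t ^ 2 ≤ q * d)
    (hZ : ρ * colNorm Z t ^ 2 ≤ (1 + 1 / 500) * d) :
    colNorm X' t ^ 2 ≤ (q + 0.005 * s + 1.005) * d := by
  have h1 := (h.1 t).2
  simp only [← colNorm_sq] at h1
  have hd : (0 : ℝ) ≤ d := Nat.cast_nonneg d
  have e1 : √(colNorm Y t ^ 2) ≤ s * √(d : ℝ) := by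
    refine Real.sqrt_le_iff.mpr ⟨by positivity, ?_⟩
    rw [mul_pow, Real.sq_sqrt hd]
    exact hY.trans (by gcongr)
  have e2 : √(ρ * colNorm Z t ^ 2) ≤ (1 + 1 / 500) * √(d : ℝ) := by
    refine Real.sqrt_le_iff.mpr ⟨by positivity, ?_⟩
    rw [mul_pow, Real.sq_sqrt hd]
    nlinarith
  have e3 : √(colNorm Y t ^ 2) * √(ρ * colNorm Z t ^ 2)
      ≤ (s * √(d : ℝ)) * ((1 + 1 / 500) * √(d : ℝ)) := by gcongr
  have e4 : (s * √(d : ℝ)) * ((1 + 1 / 500) * √(d : ℝ)) = (1 + 1 / 500) * (s * d) := by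
    have := Real.mul_self_sqrt hd
    linear_combination (s * (1 + 1 / 500)) * this
  rw [e4] at e3
  have : 0 ≤ s * d := by positivity
  nlinarith

section Layers

variable {L d nHead dHead k n : ℕ} {hd : d = nHead * dHead} {σ : ℝ → ℝ} {stσ pσ : ℝ}

namespace Layer.Concentrated

variable {θ : Layer d nHead dHead k n} {X : Matrix (Fin d) (Fin n) ℝ}

lemma colNorm_att_ne_zero (h : θ.Concentrated hd σ (1 / 500) stσ pσ X) {t : Fin n}
    (hX : colNorm X t ≠ 0) : colNorm (θ.att hd X) t ≠ 0 :=
  h.att.colNorm_ne_zero (by norm_num) zero_le_one hX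

lemma colNorm_out_ne_zero (h : θ.Concentrated hd σ (1 / 500) stσ pσ X) {t : Fin n}
    (hX : colNorm X t ≠ 0) : colNorm (θ.out hd σ X) t ≠ 0 :=
  h.out.colNorm_ne_zero (by norm_num) (by positivity) (h.colNorm_att_ne_zero hX)

lemma colNorm_att_sq_le (h : θ.Concentrated hd σ (1 / 500) stσ pσ X) {r : ℝ} (hr : 0 ≤ r)
    {t : Fin n} (hX : colNorm X t ^ 2 ≤ r ^ 2 * d) :
    colNorm (θ.att hd X) t ^ 2 ≤ (r ^ 2 + 0.005 * r + 1.005) * d :=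
  h.att.colNorm_sq_le hr le_rfl hX (by rw [one_mul]; exact h.heads t)

/-- The two sublayers turn `r²` into at most `r² + 0.01 r + 2.015`, which is below `(r + 1.05)²` for
`r ≥ 1.05`. The norm bound taken after attention is `r + 1`. -/
lemma colNorm_out_sq_le (hk : 1 ≤ k) (h : θ.Concentrated hd σ (1 / 500) stσ pσ X) {r : ℝ}
    (hr : 1.05 ≤ r) {t : Fin n} (hX : colNorm X t ^ 2 ≤ r ^ 2 * d) :
    colNorm (θ.out hd σ X) t ^ 2 ≤ (r + 1.05) ^ 2 * d := by
  have hr0 : 0 ≤ r := by linarith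
  have hk0 : (0 : ℝ) < k := by exact_mod_cast hk
  refine (h.out.colNorm_sq_le (s := r + 1) (by linarith) (by nlinarith)
    (h.colNorm_att_sq_le hr0 hX) ?_).trans ?_
  · have := h.postAct t
    rw [div_mul_eq_mul_div, div_le_iff₀ hk0]
    have hd0 : (0 : ℝ) ≤ d := Nat.cast_nonneg d
    nlinarith [mul_le_mul_of_nonneg_left this hd0]
  · gcongr
    nlinarith

/-- The post-activations force a lower bound on the operator norm of the layer output. -/
lemma opNorm_out_sq_ge (hd1 : 1 ≤ d) (hk1 : 1 ≤ k) (hn1 : 1 ≤ n) (hp : 0 < pσ)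
    (h : θ.Concentrated hd σ (1 / 500) stσ pσ X) (hX : ∀ t, colNorm X t ≠ 0) :
    0 < stσ ∧ 0.996 * (n * d * pσ) / stσ ≤ opNorm (θ.out hd σ X) ^ 2 := by
  have hd0 : (0 : ℝ) < d := by exact_mod_cast hd1
  have hk0 : (0 : ℝ) < k := by exact_mod_cast hk1
  have hn0 : (0 : ℝ) < n := by exact_mod_cast hn1
  obtain ⟨h1, h2⟩ := h.spike
  rw [frobSq_rmsNorm fun t => h.colNorm_att_ne_zero (hX t)] at h2
  have h3 : (k : ℝ) * pσ * n ≤ frobSq (θ.postAct hd σ X) := by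
    refine le_of_eq_of_le ?_ h2
    field_simp
  have h4 : 0 < frobSq (θ.postAct hd σ X) := lt_of_lt_of_le (by positivity) h3
  -- The stable rank of the zero matrix is zero, so its upper bound carries information only once
  -- the Frobenius lower bound excludes that matrix.
  have h5 : opNorm (θ.postAct hd σ X) ≠ 0 := fun h0 => by
    rw [opNorm_eq_zero h0] at h4
    simp [frobSq] at h4
  have h6 : 0 < opNorm (θ.postAct hd σ X) ^ 2 := by positivity
  unfold stableRank at h1
  have hst : 0 < stσ := lt_of_lt_of_le (div_pos h4 h6) h1
  rw [div_le_iff₀ h6] at h1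
  refine ⟨hst, le_trans ?_ h.out.2.2⟩
  rw [div_le_iff₀ hst]
  have h7 : (d : ℝ) / k * (k * pσ * n) ≤ d / k * (stσ * opNorm (θ.postAct hd σ X) ^ 2) :=
    mul_le_mul_of_nonneg_left (h3.trans h1) (by positivity)
  have h8 : (d : ℝ) / k * (k * pσ * n) = n * d * pσ := by field_simp
  rw [h8] at h7
  linarith

end Layer.Concentrated

variable {θ : Fin L → Layer d nHead dHead k n} {X₀ : Matrix (Fin d) (Fin n) ℝ}

lemma hidden_succ (j : Fin L) :
    hidden hd σ θ X₀ j.succ = (θ j).out hd σ (hidden hd σ θ X₀ j.castSucc) :=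
  Fin.induction_succ _ _ _

lemma hidden_zero : hidden hd σ θ X₀ 0 = X₀ := rfl

/-- Concentration of a layer is only known for inputs without vanishing columns. The induction
discharges this condition layer by layer. -/
lemma colNorm_hidden_ne_zero (h0 : ∀ t, colNorm X₀ t ≠ 0)
    (h : ∀ ℓ : Fin L, (∀ t, colNorm (hidden hd σ θ X₀ ℓ.castSucc) t ≠ 0) →
      (θ ℓ).Concentrated hd σ (1 / 500) stσ pσ (hidden hd σ θ X₀ ℓ.castSucc))
    (m : Fin (L + 1)) : ∀ t, colNorm (hidden hd σ θ X₀ m) t ≠ 0 := by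
  induction m using Fin.induction with
  | zero => exact h0
  | succ j ih =>
    rw [hidden_succ]
    exact fun t => (h j ih).colNorm_out_ne_zero (ih t)

lemma colNorm_hidden_sq_le (hk1 : 1 ≤ k) (h0 : ∀ t, colNorm X₀ t ^ 2 ≤ 1.002 * d)
    (h : ∀ ℓ : Fin L, (θ ℓ).Concentrated hd σ (1 / 500) stσ pσ (hidden hd σ θ X₀ ℓ.castSucc))
    (m : Fin (L + 1)) :
    ∀ t, colNorm (hidden hd σ θ X₀ m) t ^ 2 ≤ (1.05 * (1 + (m : ℝ))) ^ 2 * d := by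
  induction m using Fin.induction with
  | zero =>
    intro t
    rw [hidden_zero]
    refine (h0 t).trans ?_
    gcongr
    norm_num
  | succ j ih =>
    intro t
    rw [hidden_succ]
    have hj : (0 : ℝ) ≤ (j : ℕ) := Nat.cast_nonneg _
    refine ((h j).colNorm_out_sq_le hk1 (r := 1.05 * (1 + (j : ℝ))) (by linarith) (ih t)).trans ?_
    refine le_of_eq ?_
    rw [Fin.val_succ]
    push_cast
    ring

lemma colNorm_att_hidden_sq_le (hk1 : 1 ≤ k) (h0 : ∀ t, colNorm X₀ t ^ 2 ≤ 1.002 * d)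
    (h : ∀ ℓ : Fin L, (θ ℓ).Concentrated hd σ (1 / 500) stσ pσ (hidden hd σ θ X₀ ℓ.castSucc))
    (ℓ : Fin L) (t : Fin n) :
    colNorm ((θ ℓ).att hd (hidden hd σ θ X₀ ℓ.castSucc)) t ^ 2 ≤ 2.2 * (1 + (ℓ : ℝ)) ^ 2 * d := by
  have hj : (0 : ℝ) ≤ (ℓ : ℕ) := Nat.cast_nonneg _
  refine ((h ℓ).colNorm_att_sq_le (r := 1.05 * (1 + (ℓ : ℝ))) (by linarith)
    (colNorm_hidden_sq_le hk1 h0 h ℓ.castSucc t)).trans ?_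
  gcongr
  nlinarith

/-- Only the last MLP update before position `m` is used, so losses do not accumulate with depth. -/
lemma opNorm_hidden_sq_ge (hd1 : 1 ≤ d) (hk1 : 1 ≤ k) (hn1 : 1 ≤ n) (hp : 0 < pσ)
    (h0 : ∀ t, colNorm X₀ t ≠ 0)
    (h : ∀ ℓ : Fin L, (θ ℓ).Concentrated hd σ (1 / 500) stσ pσ (hidden hd σ θ X₀ ℓ.castSucc))
    {m : Fin (L + 1)} (hm : 1 ≤ (m : ℕ)) :
    0 < stσ ∧ 0.996 * (n * d * pσ) / stσ ≤ opNorm (hidden hd σ θ X₀ m) ^ 2 := by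
  obtain ⟨j, rfl⟩ := Fin.exists_succ_eq.mpr (show m ≠ 0 by rintro rfl; simp at hm)
  rw [hidden_succ]
  exact (h j).opNorm_out_sq_ge hd1 hk1 hn1 hp 
    (colNorm_hidden_ne_zero h0 (fun ℓ _ => h ℓ) _)

/-- The ratio of the two bounds is `1.05² (1 + m)² / 0.996 * (stσ / pσ)`. Since `m ≥ 1` gives `1 + m
≤ 2 m`, the term with `4.3 m (m + 1)` already dominates it; the linear term is nonnegative slack. -/
lemma stableRank_rmsNorm_hidden_le (hd1 : 1 ≤ d) (hk1 : 1 ≤ k) (hn1 : 1 ≤ n) (hp : 0 < pσ)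
    (h0 : ∀ t, colNorm X₀ t ≠ 0) (h0' : ∀ t, colNorm X₀ t ^ 2 ≤ 1.002 * d)
    (h : ∀ ℓ : Fin L, (θ ℓ).Concentrated hd σ (1 / 500) stσ pσ (hidden hd σ θ X₀ ℓ.castSucc))
    {m : Fin (L + 1)} (hm : 1 ≤ (m : ℕ)) :
    stableRank (rmsNorm (hidden hd σ θ X₀ m))
      ≤ 2.1 * stσ * (1 + (m : ℝ)) + 4.3 * (stσ / pσ) * ((m : ℝ) * ((m : ℝ) + 1)) := by
  obtain ⟨hst, hop⟩ := opNorm_hidden_sq_ge hd1 hk1 hn1 hp h0 h hm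
  have hm1 : (1 : ℝ) ≤ (m : ℕ) := by exact_mod_cast hm
  have hd0 : (0 : ℝ) < d := by exact_mod_cast hd1
  have hn0 : (0 : ℝ) < n := by exact_mod_cast hn1
  refine le_trans (stableRank_rmsNorm_le (r := 4.3 * (stσ / pσ) * ((m : ℝ) * ((m : ℝ) + 1)))
    (by positivity) (by positivity) (colNorm_hidden_sq_le hk1 h0' h m) hop (by positivity) ?_) ?_
  · have e : 4.3 * (stσ / pσ) * ((m : ℝ) * ((m : ℝ) + 1)) * (0.996 * (n * d * pσ) / stσ)
        = n * d * (4.3 * 0.996 * ((m : ℝ) * ((m : ℝ) + 1))) := by field_simp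
    rw [e]
    gcongr
    nlinarith
  · have : 0 ≤ 2.1 * stσ * (1 + (m : ℝ)) := by positivity
    linarith

lemma stableRank_rmsNorm_att_hidden_le (hd1 : 1 ≤ d) (hk1 : 1 ≤ k) (hn1 : 1 ≤ n) (hp : 0 < pσ)
    (h0 : ∀ t, colNorm X₀ t ≠ 0) (h0' : ∀ t, colNorm X₀ t ^ 2 ≤ 1.002 * d)
    (h : ∀ ℓ : Fin L, (θ ℓ).Concentrated hd σ (1 / 500) stσ pσ (hidden hd σ θ X₀ ℓ.castSucc))
    {ℓ : Fin L} (hℓ : 1 ≤ (ℓ : ℕ)) :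
    stableRank (rmsNorm ((θ ℓ).att hd (hidden hd σ θ X₀ ℓ.castSucc)))
      ≤ 6.4 * stσ * (1 + (ℓ : ℝ)) + 13 * (stσ / pσ) * ((ℓ : ℝ) * ((ℓ : ℝ) + 1)) := by
  obtain ⟨hst, hop⟩ := opNorm_hidden_sq_ge hd1 hk1 hn1 hp h0 h (m := ℓ.castSucc) hℓ
  have hm1 : (1 : ℝ) ≤ (ℓ : ℕ) := by exact_mod_cast hℓ
  have hd0 : (0 : ℝ) < d := by exact_mod_cast hd1
  have hn0 : (0 : ℝ) < n := by exact_mod_cast hn1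
  have hop' := (h ℓ).att.2.1
  refine le_trans (stableRank_rmsNorm_le (r := 13 * (stσ / pσ) * ((ℓ : ℝ) * ((ℓ : ℝ) + 1)))
    -- The attention update loses one more factor `1 - 2δ = 0.996`.
    (s := 0.996 * (0.996 * (n * d * pσ) / stσ))
    (by positivity) (by positivity) (colNorm_att_hidden_sq_le hk1 h0' h ℓ) ?_ (by positivity) ?_) ?_
  · linarith
  · have e : 13 * (stσ / pσ) * ((ℓ : ℝ) * ((ℓ : ℝ) + 1)) * (0.996 * (0.996 * (n * d * pσ) / stσ))
        = n * d * (13 * 0.996 * 0.996 * ((ℓ : ℝ) * ((ℓ : ℝ) + 1))) := by field_simp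
    rw [e]
    refine mul_le_mul_of_nonneg_left ?_ (by positivity)
    nlinarith
  · have : 0 ≤ 6.4 * stσ * (1 + (ℓ : ℝ)) := by positivity
    linarith

end Layers

/-! ### The embedding -/

section Embedding

variable {d n V : ℕ}

lemma exists_card_eq_pMax (hn : 1 ≤ n) (tok : Fin n → Fin V) :
    0 < pMax tok ∧ ∃ j, ((Finset.univ.filter fun t => tok t = j).card : ℝ) = n * pMax tok := by
  have hn0 : (0 : ℝ) < n := by exact_mod_cast hn
  have : Nonempty (Fin V) := ⟨tok ⟨0, hn⟩⟩
  obtain ⟨j, hj⟩ := exists_eq_ciSup_of_finite (f := tokenFreq tok)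
  refine ⟨?_, j, ?_⟩
  · have h1 : tokenFreq tok (tok ⟨0, hn⟩) ≤ pMax tok :=
      le_ciSup (Set.finite_range (tokenFreq tok)).bddAbove _
    refine lt_of_lt_of_le ?_ h1
    refine div_pos ?_ hn0
    exact_mod_cast Finset.card_pos.mpr ⟨(⟨0, hn⟩ : Fin n), by simp⟩
  · rw [pMax, ← hj, tokenFreq]
    field_simp

/-- The most frequent token produces `n * pMax tok` identical columns, and the indicator of their
positions is the test vector. -/
lemma opNorm_embed_sq_ge (hn : 1 ≤ n) (tok : Fin n → Fin V) {E : Matrix (Fin d) (Fin V) ℝ} {c : ℝ}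
    (hE : ∀ t, c ≤ colNorm (embed tok E) t ^ 2) :
    n * pMax tok * c ≤ opNorm (embed tok E) ^ 2 := by
  obtain ⟨hpos, j, hj⟩ := exists_card_eq_pMax hn tok
  have hn0 : (0 : ℝ) < n := by exact_mod_cast hn
  have hne : 0 < (Finset.univ.filter fun t => tok t = j).card := by
    have : (0 : ℝ) < (Finset.univ.filter fun t => tok t = j).card := by rw [hj]; positivity
    exact_mod_cast this
  obtain ⟨t, ht⟩ := Finset.card_pos.mp hne
  have htj : tok t = j := by simpa using ht
  have h1 := card_mul_colNorm_sq_le (embed tok E) (Finset.univ.filter fun t => tok t = j)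
    (fun i => E i j) fun s hs i => by
      have : tok s = j := by simpa using hs
      simp [embed, this]
  rw [hj] at h1
  refine le_trans ?_ h1
  gcongr
  have := hE t
  rw [colNorm_sq] at this
  simpa [embed, htj] using this

/-- The embedding is a Gaussian update of the zero matrix: `E` times the matrix of one-hot columns,
each of norm one, with `ρ = d`. -/
lemma gaussianMatrix_embed_le (tok : Fin n → Fin V) {δ : ℝ} (hδ0 : 0 < δ) (hδ1 : δ ≤ 1 / 2) :
    (gaussianMatrix d V 1).real {E | ¬ ∀ t, (1 - 2 * δ) * d ≤ colNorm (embed tok E) t ^ 2 ∧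
        colNorm (embed tok E) t ^ 2 ≤ (1 + δ) * d}
      ≤ (n + 2) * (4 * Real.exp (-(δ ^ 2 / 16 * d))) := by
  set Z : Matrix (Fin V) (Fin n) ℝ := (1 : Matrix (Fin V) (Fin V) ℝ).submatrix id tok with hZ
  have hZ1 : ∀ t, ∑ j, Z j t ^ 2 = 1 := fun t => by
    simp [hZ, Matrix.one_apply]
  have hEZ : ∀ E : Matrix (Fin d) (Fin V) ℝ, 0 + E * Z = embed tok E := fun E => by
    ext i t
    simp [hZ, embed, Matrix.mul_apply, Matrix.one_apply]
  refine le_trans (measureReal_mono fun E hE => ?_)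
    (measureReal_not_matUpdate_le (a := d) (v := 1) one_ne_zero hδ0 hδ1 0 Z)
  intro hM
  refine hE fun t => ?_
  have h := hM.1 t
  rw [hEZ] at h
  unfold VecUpdate at h
  simp only [← colNorm_sq (embed tok E)] at h
  simpa [hZ1] using h

end Embedding

/-! ### The random network -/

section Random

variable {L d nHead dHead k n V : ℕ} {hd : d = nHead * dHead} {σ : ℝ → ℝ}

lemma measurable_hidden {α : Type*} [MeasurableSpace α] (hσ : Measurable σ)
    {P : Fin L → α → Fin nHead → Matrix (Fin n) (Fin n) ℝ}
    {w : Fin L → α → WeightSpace d nHead dHead k} {X₀ : α → Matrix (Fin d) (Fin n) ℝ}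
    (hP : ∀ j, Measurable (P j)) (hw : ∀ j, Measurable (w j)) (hX₀ : Measurable X₀)
    (m : Fin (L + 1)) :
    Measurable fun x => hidden hd σ (fun j => Layer.mk' (P j x) (w j x)) (X₀ x) m := by
  induction m using Fin.induction with
  | zero => exact hX₀
  | succ j ih =>
    simp_rw [hidden_succ]
    exact Layer.measurable_out hd hσ (hP j) (hw j) ih

lemma hidden_congr {θ θ' : Fin L → Layer d nHead dHead k n} {X₀ : Matrix (Fin d) (Fin n) ℝ}
    {m : Fin (L + 1)} (h : ∀ j : Fin L, j.castSucc < m → θ j = θ' j) :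
    hidden hd σ θ X₀ m = hidden hd σ θ' X₀ m := by
  induction m using Fin.induction with
  | zero => rw [hidden_zero, hidden_zero]
  | succ j ih =>
    have hj := h j j.castSucc_lt_succ
    have hi := ih fun i hi => h i (hi.trans j.castSucc_lt_succ)
    rw [hidden_succ, hidden_succ, hj, hi]

lemma measurable_embed (tok : Fin n → Fin V) :
    Measurable (embed tok : Matrix (Fin d) (Fin V) ℝ → Matrix (Fin d) (Fin n) ℝ) :=
  measurable_matrix fun i t => measurable_entry measurable_id i (tok t)

lemma measurableSet_concentrated {α : Type*} [MeasurableSpace α] (hσ : Measurable σ)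
    (δ stσ pσ : ℝ) {P : α → Fin nHead → Matrix (Fin n) (Fin n) ℝ}
    {w : α → WeightSpace d nHead dHead k} {X : α → Matrix (Fin d) (Fin n) ℝ}
    (hP : Measurable P) (hw : Measurable w) (hX : Measurable X) :
    MeasurableSet {x | (Layer.mk' (P x) (w x)).Concentrated hd σ δ stσ pσ (X x)} := by
  have h1 := Layer.measurable_heads hd hP hw hX
  have h2 := Layer.measurable_att hd hP hw hX
  have h3 := Layer.measurable_postAct hd hσ hP hw hX
  have h4 := Layer.measurable_out hd hσ hP hw hX
  have m1 := measurableSet_forall fun t => measurableSet_le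
    ((measurable_colNorm h1 t).pow_const 2) (measurable_const (a := (1 + δ) * (d : ℝ)))
  have m2 := measurableSet_matUpdate δ 1 hX h1 h2
  have m3 := measurableSet_and
    (measurableSet_le (measurable_stableRank h3) (measurable_const (a := stσ)))
    (measurableSet_le ((measurable_frobSq (measurable_rmsNorm h2)).const_mul ((k : ℝ) * pσ / d))
      (measurable_frobSq h3))
  have m4 := measurableSet_forall fun t => measurableSet_le
    ((measurable_colNorm h3 t).pow_const 2) (measurable_const (a := (1 + δ) * (k : ℝ)))
  have m5 := measurableSet_matUpdate δ (d / k) h2 h3 h4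
  convert measurableSet_and m1 (measurableSet_and m2 (measurableSet_and m3
    (measurableSet_and m4 m5))) using 1
  ext x
  exact ⟨fun h => ⟨h.1, h.2, h.3, h.4, h.5⟩, fun ⟨a1, a2, a3, a4, a5⟩ => ⟨a1, a2, a3, a4, a5⟩⟩

variable {Ω : Type*} [MeasurableSpace Ω] {μ : Measure Ω}
  {E : Ω → Matrix (Fin d) (Fin V) ℝ} {θ : Fin L → Ω → Layer d nHead dHead k n}

/-- The input and the mixing matrices of a layer are independent of its weights. -/
lemma GaussianInit.indepFun_hidden (hG : GaussianInit μ E θ) (hσ : Measurable σ)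
    (tok : Fin n → Fin V) (ℓ : Fin L) :
    AEMeasurable (fun ω => (hidden hd σ (θ · ω) (embed tok (E ω)) ℓ.castSucc, (θ ℓ ω).P)) μ ∧
    IndepFun (fun ω => (hidden hd σ (θ · ω) (embed tok (E ω)) ℓ.castSucc, (θ ℓ ω).P))
      (fun ω => (θ ℓ ω).weights) μ := by
  set past : Ω → Matrix (Fin d) (Fin V) ℝ ×
      ({j : Fin L // j < ℓ} → WeightSpace d nHead dHead k) ×
      ({j : Fin L // j ≤ ℓ} → Fin nHead → Matrix (Fin n) (Fin n) ℝ) := fun ω =>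
    (E ω, (fun j : {j : Fin L // j < ℓ} => (θ j ω).weights),
      fun j : {j : Fin L // j ≤ ℓ} => (θ j ω).P) with hpast
  have hpastm : AEMeasurable past μ := by
    refine hG.law_embedding.aemeasurable.prodMk (AEMeasurable.prodMk ?_ ?_)
    · exact aemeasurable_pi_iff.mpr fun j => (hG.law_weights j).aemeasurable
    · refine Measurable.aemeasurable (measurable_pi_iff.mpr fun j => measurable_pi_iff.mpr fun h => ?_)
      exact hG.measurable_P j h
  -- `F` recomputes the input of layer `ℓ` from the past alone. Data missing from the past is
  -- replaced by zero, which is harmless because that input only involves layers `j < ℓ`.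
  let F : (Matrix (Fin d) (Fin V) ℝ × ({j : Fin L // j < ℓ} → WeightSpace d nHead dHead k) ×
      ({j : Fin L // j ≤ ℓ} → Fin nHead → Matrix (Fin n) (Fin n) ℝ)) →
      Matrix (Fin d) (Fin n) ℝ × (Fin nHead → Matrix (Fin n) (Fin n) ℝ) := fun p =>
    (hidden hd σ (fun j => Layer.mk' (if h : j ≤ ℓ then p.2.2 ⟨j, h⟩ else 0)
      (if h : j < ℓ then p.2.1 ⟨j, h⟩ else 0)) (embed tok p.1) ℓ.castSucc, p.2.2 ⟨ℓ, le_rfl⟩)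
  have hF : Measurable F := by
    refine Measurable.prodMk (measurable_hidden hσ (fun j => ?_) (fun j => ?_)
      ((measurable_embed tok).comp measurable_fst) _)
      ((measurable_pi_apply _).comp measurable_snd.snd)
    · split_ifs with h
      · exact (measurable_pi_apply _).comp measurable_snd.snd
      · exact measurable_const
    · split_ifs with h
      · exact (measurable_pi_apply _).comp measurable_snd.fst
      · exact measurable_const
  have hFp : (fun ω => (hidden hd σ (θ · ω) (embed tok (E ω)) ℓ.castSucc, (θ ℓ ω).P))
      = F ∘ past := by
    funext ω
    refine Prod.ext (?_ : hidden hd σ (θ · ω) (embed tok (E ω)) ℓ.castSucc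
      = hidden hd σ _ (embed tok (E ω)) ℓ.castSucc) rfl
    refine hidden_congr fun j hj => ?_
    have hj : j < ℓ := hj
    simp only [hpast, dif_pos hj, dif_pos hj.le]
    rfl
  rw [hFp]
  exact ⟨hF.comp_aemeasurable hpastm, (hG.indep ℓ).comp hF measurable_id⟩

lemma GaussianInit.measureReal_not_concentrated_le [IsProbabilityMeasure μ]
    (hG : GaussianInit μ E θ)
    {stσ pσ δ : ℝ} {Psucc : ℕ → ℕ → ℕ → ℝ} (hspike : MeanSpike σ stσ pσ Psucc) (hδ0 : 0 < δ)
    (hδ1 : δ < 1 / 2) (hd1 : 1 ≤ d) (hk1 : 1 ≤ k) (hn1 : 1 ≤ n) (tok : Fin n → Fin V)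
    (ℓ : Fin L) :
    μ.real {ω | (∀ t, colNorm (hidden hd σ (θ · ω) (embed tok (E ω)) ℓ.castSucc) t ≠ 0) ∧
        ¬ (θ ℓ ω).Concentrated hd σ δ stσ pσ (hidden hd σ (θ · ω) (embed tok (E ω)) ℓ.castSucc)}
      ≤ 25 * n * Real.exp (-(δ ^ 2 / 16 * d)) + n * Real.exp (-(δ ^ 2 / 16 * k))
        + (1 - Psucc d k n) := by
  have hσ : Measurable σ := hspike.lipschitz.continuous.measurable
  obtain ⟨hm, hind⟩ := hG.indepFun_hidden (hd := hd) hσ tok ℓ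
  have hw := hG.law_weights ℓ
  have hP1 : Psucc d k n ≤ 1 :=
    (hspike.bound d k n hd1 hk1 hn1 0 fun s t => by simp [colNorm]).trans measureReal_le_one
  set Y := fun ω => (hidden hd σ (θ · ω) (embed tok (E ω)) ℓ.castSucc, (θ ℓ ω).P)
  have hε : 0 ≤ 25 * n * Real.exp (-(δ ^ 2 / 16 * d)) + n * Real.exp (-(δ ^ 2 / 16 * k))
        + (1 - Psucc d k n) := by
    have := sub_nonneg.mpr hP1
    positivity
  have hlaw := (indepFun_iff_map_prod_eq_prod_map_map hm hw.aemeasurable).mp hind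
  rw [hw.map_eq] at hlaw
  -- Slices under the product law run over all inputs and mixing matrices, so nonvanishing columns
  -- and stochasticity are built into the event; other slices are empty.
  set S : Set ((Matrix (Fin d) (Fin n) ℝ × (Fin nHead → Matrix (Fin n) (Fin n) ℝ)) ×
      WeightSpace d nHead dHead k) := {q | ((∀ t, colNorm q.1.1 t ≠ 0) ∧
        ∀ h, ColumnStochastic (q.1.2 h)) ∧
        ¬ (Layer.mk' q.1.2 q.2).Concentrated hd σ δ stσ pσ q.1.1}
  have hS : MeasurableSet S := by
    refine measurableSet_and (measurableSet_and (measurableSet_forall fun t => ?_)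
      (measurableSet_forall fun h => ?_)) (measurableSet_not ?_)
    · exact measurableSet_not
        (measurableSet_eq_fun (measurable_colNorm measurable_fst.fst t) measurable_const)
    · exact measurableSet_columnStochastic ((measurable_pi_apply h).comp measurable_fst.snd)
    · exact measurableSet_concentrated hσ δ stσ pσ measurable_fst.snd measurable_snd
        measurable_fst.fst
  have := Measure.isProbabilityMeasure_map hm
  have hbound : ((μ.map Y).prod (weightLaw d nHead dHead k)).real S ≤ _ :=
    measureReal_prod_le_of_right hS hε fun p => by
      by_cases hp : (∀ t, colNorm p.1 t ≠ 0) ∧ ∀ h, ColumnStochastic (p.2 h)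
      · exact le_trans (measureReal_mono fun w hw => hw.2)
          (weightLaw_not_concentrated_le hd hspike hδ0 hδ1 hd1 hk1 hn1 hp.1 hp.2)
      · refine le_trans (le_of_eq ?_) hε
        convert measureReal_empty
        exact Set.eq_empty_of_forall_notMem fun w hw => hp hw.1
  rw [← hlaw, measureReal_def, Measure.map_apply_of_aemeasurable (hm.prodMk hw.aemeasurable) hS]
    at hbound
  refine le_trans (measureReal_mono fun ω hω => ?_) hbound
  exact ⟨⟨hω.1, fun h => hG.stochastic_P ℓ h ω⟩, hω.2⟩

/-- Half of the exponent `2 c x` absorbs the union bound over `n` columns, since `log n ≤ c x / L² ≤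
c x`; the other half remains. -/
lemma natCast_mul_exp_le {x c : ℝ} (hc : 0 < c) (hL : 1 ≤ L) (hn1 : 1 ≤ n) (hx : 0 ≤ x)
    (h : 1 / c * (L : ℝ) ^ 2 * Real.log ((n : ℝ) * L) ≤ x) :
    n * Real.exp (-(2 * c * x)) ≤ Real.exp (-(c * (x / (L : ℝ) ^ 2))) := by
  have hL1 : (1 : ℝ) ≤ L := by exact_mod_cast hL
  have hn : (1 : ℝ) ≤ n := by exact_mod_cast hn1
  have hL2 : (1 : ℝ) ≤ (L : ℝ) ^ 2 := one_le_pow₀ hL1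
  have h1 : Real.log n ≤ Real.log ((n : ℝ) * L) :=
    Real.log_le_log (by linarith) (le_mul_of_one_le_right (by linarith) hL1)
  have h2 : Real.log ((n : ℝ) * L) ≤ c * (x / (L : ℝ) ^ 2) := by
    rw [← mul_div_assoc, le_div_iff₀ (by linarith)]
    have : 1 / c * (L : ℝ) ^ 2 * Real.log ((n : ℝ) * L)
        = Real.log ((n : ℝ) * L) * (L : ℝ) ^ 2 / c := by ring
    rw [this, div_le_iff₀ hc] at h
    linarith
  have h3 : x / (L : ℝ) ^ 2 ≤ x := div_le_self hx hL2
  calc n * Real.exp (-(2 * c * x)) = Real.exp (Real.log n + -(2 * c * x)) := by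
        rw [Real.exp_add, Real.exp_log (by linarith)]
    _ ≤ _ := by
        rw [Real.exp_le_exp]
        nlinarith

/-- The constants come from `1.002 / 0.996` before attention and `2.2 / 0.996²` after it; `pMax`
enters through the operator norm of the embedding. -/
lemma stableRank_embed_bounds {hd : d = nHead * dHead} {stσ pσ : ℝ} (hL : 1 ≤ L) (hd1 : 1 ≤ d)
    (hk1 : 1 ≤ k) (hn1 : 1 ≤ n) (tok : Fin n → Fin V) {E : Matrix (Fin d) (Fin V) ℝ}
    {θ : Fin L → Layer d nHead dHead k n}
    (hE : ∀ t, 0.996 * d ≤ colNorm (embed tok E) t ^ 2 ∧ colNorm (embed tok E) t ^ 2 ≤ 1.002 * d)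
    (h : ∀ ℓ : Fin L, (θ ℓ).Concentrated hd σ (1 / 500) stσ pσ
      (hidden hd σ θ (embed tok E) ℓ.castSucc)) :
    stableRank (embed tok E) ≤ 1.01 / pMax tok ∧
      stableRank (Arms hd σ θ (embed tok E) ⟨0, hL⟩) ≤ 1.03 / pMax tok ∧
      stableRank (Amlp hd σ θ (embed tok E) ⟨0, hL⟩) ≤ 6.03 / pMax tok := by
  have hd0 : (0 : ℝ) < d := by exact_mod_cast hd1
  have hn0 : (0 : ℝ) < n := by exact_mod_cast hn1
  obtain ⟨hp, -⟩ := exists_card_eq_pMax hn1 tok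
  have hop := opNorm_embed_sq_ge hn1 tok fun t => (hE t).1
  have hhid : hidden hd σ θ (embed tok E) (⟨0, hL⟩ : Fin L).castSucc = embed tok E := hidden_zero
  have e : ∀ a b : ℝ, a / pMax tok * (n * pMax tok * (b * d)) = n * d * (a * b) := fun a b => by
    field_simp
  have hnd : (0 : ℝ) < n * d := by positivity
  refine ⟨?_, ?_, ?_⟩
  · refine stableRank_le_of (F := n * d * 1.002) ?_ (by positivity) hop ?_ (by positivity)
    · rw [frobSq_eq_sum_colNorm_sq]
      refine (Finset.sum_le_sum fun t _ => (hE t).2).trans (le_of_eq ?_)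
      simp; ring
    · rw [e]; gcongr; norm_num
  · unfold Arms
    rw [hhid]
    refine stableRank_rmsNorm_le (R := 1.002) (by norm_num) (by positivity) (fun t => (hE t).2) hop
      (by positivity) ?_
    rw [e]; gcongr; norm_num
  · unfold Amlp
    have h1 := colNorm_att_hidden_sq_le hk1 (fun t => (hE t).2) h ⟨0, hL⟩
    have h2 := (h ⟨0, hL⟩).att.2.1
    rw [hhid] at h1 h2 ⊢
    refine stableRank_rmsNorm_le (R := 2.2) (s := n * pMax tok * (0.996 * 0.996 * d)) (by norm_num)
      (by positivity) (fun t => ?_) ?_ (by positivity) ?_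
    · simpa using h1 t
    · linarith
    · rw [e]; gcongr; norm_num

end Random

end

end MSITransformer

-- Union bound over the embedding and all layers

open MSITransformer in
theorem mainTheorem3 :
    ∃ c C : ℝ, 0 < c ∧ 0 < C ∧
      ∀ (L nHead dHead d k n V : ℕ), 1 ≤ nHead → 1 ≤ d → 1 ≤ k → 1 ≤ n →
      ∀ (hL : 1 ≤ L) (hd : d = nHead * dHead) (tok : Fin n → Fin V)
        (σ : ℝ → ℝ) (stσ pσ : ℝ) (Psucc : ℕ → ℕ → ℕ → ℝ),
        0 < pσ → MeanSpike σ stσ pσ Psucc →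
      ∀ (Ω : Type*) [MeasurableSpace Ω] (μ : Measure Ω) [IsProbabilityMeasure μ]
        (E : Ω → Matrix (Fin d) (Fin V) ℝ) (θ : Fin L → Ω → Layer d nHead dHead k n),
        GaussianInit μ E θ →
        C * (L : ℝ) ^ 2 * Real.log ((n : ℝ) * L) ≤ d →
        C * (L : ℝ) ^ 2 * Real.log ((n : ℝ) * L) ≤ k →
        1 - C * L * Real.exp (-(c * (d / (L : ℝ) ^ 2)))
            - C * L * Real.exp (-(c * (k / (L : ℝ) ^ 2)))
            - L * (1 - Psucc d k n)
          ≤ μ.real {ω |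
            -- MLP post-activations
            (∀ ℓ : Fin L, stableRank (B hd σ (θ · ω) (embed tok (E ω)) ℓ) ≤ stσ) ∧
            -- embedding layer
            (stableRank (embed tok (E ω)) ≤ 1.01 / pMax tok ∧
              stableRank (Arms hd σ (θ · ω) (embed tok (E ω)) ⟨0, hL⟩) ≤ 1.03 / pMax tok ∧
              stableRank (Amlp hd σ (θ · ω) (embed tok (E ω)) ⟨0, hL⟩) ≤ 6.03 / pMax tok) ∧
            -- RMS activations at depth at least one
            (∀ ℓ : Fin L, 1 ≤ (ℓ : ℕ) →
              stableRank (Arms hd σ (θ · ω) (embed tok (E ω)) ℓ)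
                ≤ 2.1 * stσ * (1 + (ℓ : ℝ)) + 4.3 * (stσ / pσ) * ((ℓ : ℝ) * ((ℓ : ℝ) + 1)) ∧
              stableRank (Amlp hd σ (θ · ω) (embed tok (E ω)) ℓ)
                ≤ 6.4 * stσ * (1 + (ℓ : ℝ)) + 13 * (stσ / pσ) * ((ℓ : ℝ) * ((ℓ : ℝ) + 1))) ∧
            -- final RMS activations
            stableRank (Afinal hd σ (θ · ω) (embed tok (E ω)))
              ≤ 2.1 * stσ * (1 + (L : ℝ)) + 4.3 * (stσ / pσ) * ((L : ℝ) * ((L : ℝ) + 1))} := by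
  -- For `δ = 1/500` the tail exponent `δ²/16` equals `2c` with `c = 1/8000000`, and `C = 1/c` lets
  -- half of it absorb `n`.
  refine ⟨1 / 8000000, 8000000, by norm_num, by norm_num, ?_⟩
  intro L nHead dHead d k n V _ hd1 hk1 hn1 hL hd tok σ stσ pσ Psucc hp hspike Ω _ μ _ E θ hG hCd hCk
  set T : Set Ω := {ω | _}
  set S₀ : Set Ω := {ω | ¬ ∀ t, (1 - 2 * (1 / 500)) * d ≤ colNorm (embed tok (E ω)) t ^ 2 ∧
    colNorm (embed tok (E ω)) t ^ 2 ≤ (1 + 1 / 500) * d}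
  set S : Fin L → Set Ω := fun ℓ =>
    {ω | (∀ t, colNorm (hidden hd σ (θ · ω) (embed tok (E ω)) ℓ.castSucc) t ≠ 0) ∧
      ¬ (θ ℓ ω).Concentrated hd σ (1 / 500) stσ pσ
        (hidden hd σ (θ · ω) (embed tok (E ω)) ℓ.castSucc)}
  have hsub : Tᶜ ⊆ S₀ ∪ ⋃ ℓ, S ℓ := by
    intro ω hω
    by_contra hcon
    simp only [Set.mem_union, Set.mem_iUnion, not_or, not_exists, S₀, S, Set.mem_ofPred_eq,
      not_not, not_and] at hcon
    obtain ⟨hE, hS⟩ := hcon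
    have hd0 : (0 : ℝ) < d := by exact_mod_cast hd1
    have hne : ∀ t, colNorm (embed tok (E ω)) t ≠ 0 := fun t h0 => by
      have := (hE t).1
      rw [h0] at this
      norm_num at this
      linarith
    have hE' : ∀ t, 0.996 * d ≤ colNorm (embed tok (E ω)) t ^ 2 ∧
        colNorm (embed tok (E ω)) t ^ 2 ≤ 1.002 * d := fun t =>
      ⟨by linarith [(hE t).1], by linarith [(hE t).2]⟩
    have hc : ∀ ℓ : Fin L, (θ ℓ ω).Concentrated hd σ (1 / 500) stσ pσ
        (hidden hd σ (θ · ω) (embed tok (E ω)) ℓ.castSucc) := fun ℓ =>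
      hS ℓ (colNorm_hidden_ne_zero (θ := (θ · ω)) hne hS ℓ.castSucc)
    refine hω ⟨fun ℓ => (hc ℓ).spike.1,
      stableRank_embed_bounds (θ := (θ · ω)) hL hd1 hk1 hn1 tok hE' hc, fun ℓ hℓ => ⟨?_, ?_⟩, ?_⟩
    · exact stableRank_rmsNorm_hidden_le (θ := (θ · ω)) hd1 hk1 hn1 hp hne (fun t => (hE' t).2) hc
        (m := ℓ.castSucc) hℓ
    · exact stableRank_rmsNorm_att_hidden_le (θ := (θ · ω)) hd1 hk1 hn1 hp hne
        (fun t => (hE' t).2) hc hℓ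
    · exact stableRank_rmsNorm_hidden_le (θ := (θ · ω)) hd1 hk1 hn1 hp hne (fun t => (hE' t).2) hc
        (m := Fin.last L) hL
  have hS₀ : μ.real S₀ ≤ (n + 2) * (4 * Real.exp (-((1 / 500) ^ 2 / 16 * d))) := by
    refine le_trans (le_of_eq ?_) (gaussianMatrix_embed_le (d := d) tok (by norm_num) (by norm_num))
    rw [measureReal_def, measureReal_def]
    congr 1
    refine hG.law_embedding.measure_eq
      (p := fun E => ¬ ∀ t, (1 - 2 * (1 / 500)) * d ≤ colNorm (embed tok E) t ^ 2 ∧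
        colNorm (embed tok E) t ^ 2 ≤ (1 + 1 / 500) * d)
      (measurableSet_not (measurableSet_forall fun t => ?_))
    have := measurable_colNorm (measurable_embed (d := d) tok) t
    exact measurableSet_and (measurableSet_le measurable_const (this.pow_const 2))
      (measurableSet_le (this.pow_const 2) measurable_const)
  have hSℓ : ∀ ℓ, μ.real (S ℓ) ≤ _ := fun ℓ =>
    hG.measureReal_not_concentrated_le hspike (by norm_num) (by norm_num) hd1 hk1 hn1 tok ℓ
  -- Subadditivity suffices, so `T` need not be shown measurable.
  have h1 : 1 ≤ μ.real T + μ.real Tᶜ := by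
    have := measureReal_union_le (μ := μ) T Tᶜ
    rwa [Set.union_compl_self, probReal_univ] at this
  have h2 : μ.real Tᶜ ≤ μ.real S₀ + ∑ ℓ, μ.real (S ℓ) :=
    (measureReal_mono hsub).trans ((measureReal_union_le _ _).trans
      (add_le_add le_rfl (measureReal_iUnion_fintype_le _)))
  have h3 := Finset.sum_le_sum fun ℓ (_ : ℓ ∈ Finset.univ) => hSℓ ℓ
  simp only [Finset.sum_const, Finset.card_univ, Fintype.card_fin, nsmul_eq_mul] at h3
  have hn : (1 : ℝ) ≤ n := by exact_mod_cast hn1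
  have hL1 : (1 : ℝ) ≤ L := by exact_mod_cast hL
  have ed := natCast_mul_exp_le (x := (d : ℝ)) (c := 1 / 8000000) (by norm_num) hL hn1
    (Nat.cast_nonneg _) (by rwa [one_div_one_div])
  have ek := natCast_mul_exp_le (x := (k : ℝ)) (c := 1 / 8000000) (by norm_num) hL hn1
    (Nat.cast_nonneg _) (by rwa [one_div_one_div])
  have c0 : ((1 : ℝ) / 500) ^ 2 / 16 = 2 * (1 / 8000000) := by norm_num
  rw [c0] at hS₀ h3
  set xd := Real.exp (-(2 * (1 / 8000000) * (d : ℝ)))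
  set xk := Real.exp (-(2 * (1 / 8000000) * (k : ℝ)))
  set yd := Real.exp (-(1 / 8000000 * ((d : ℝ) / (L : ℝ) ^ 2)))
  set yk := Real.exp (-(1 / 8000000 * ((k : ℝ) / (L : ℝ) ^ 2)))
  have hxd : 0 ≤ xd := Real.exp_nonneg _
  have hyd : 0 ≤ yd := Real.exp_nonneg _
  have hyk : 0 ≤ yk := Real.exp_nonneg _
  have g1 : xd ≤ n * xd := le_mul_of_one_le_left hxd hn
  have g2 : yd ≤ L * yd := le_mul_of_one_le_left hyd hL1
  have g3 : (L : ℝ) * (n * xd) ≤ L * yd := mul_le_mul_of_nonneg_left ed (by linarith)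
  have g4 : (L : ℝ) * (n * xk) ≤ L * yk := mul_le_mul_of_nonneg_left ek (by linarith)
  have g5 : 0 ≤ (L : ℝ) * yk := by positivity
  have g6 : 0 ≤ (L : ℝ) * yd := by positivity
  -- The embedding contributes at most `12 n xd` and the layers `25 L n xd + L n xk` plus the
  -- activation failures; the coefficients `37` and `1` of `L yd` and `L yk` are far below `C`.
  nlinarith
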